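/- Let $B=(B_1,\dots,B_g)$ be a tuple of $d\times d$ complex matrices, let $c\in\mathbb C^d$, and let $K$ be a $d\times d$ signature matrix, i.e. $K^*=K$ and $K^2=I_d$. For a tuple $X=(X_1,\dots,X_g)$ of $n\times n$ complex matrices put $X^*=(X_1^*,\dots,X_g^*)$ and $\Lambda_B(X)=\sum_j B_j\otimes X_j$, and consider the symmetric descriptor realization $$r(x,x^*)=c^*\bigl(K-\Lambda_B(x)-\Lambda_{B^*}(x^*)\bigr)^{-1}c,$$ evaluated at matrix tuples $X,Y$ (substituted for $x$ and $x^*$) by $$r(X,Y)=(c\otimes I_n)^*\bigl(K\otimes I_n-\Lambda_B(X)-\Lambda_{B^*}(Y)\bigr)^{-1}(c\otimes I_n)$$ whenever the inverse exists. Its complex Hessian at $X$ in direction $H$ is the mixed derivative, in real $s,t$, $$r_{x,x^*}(X,X^*)[H,H^*]=\frac{\partial}{\partial s}\frac{\partial}{\partial t}\,r\bigl(X+tH,(X+sH)^*\bigr)\Big|_{s=t=0}.$$ For $\varepsilon>0$ the free ball $\mathbb B_\varepsilon$ consists, for each $n$, of the $g$-tuples $X$ of $n\times n$ matrices with $\sum_j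 X_j^*X_j\prec\varepsilon^2 I_n$. Say that $r$ is plush on $\mathbb B_\varepsilon$ if, for every $n$ and every $X\in\mathbb B_\varepsilon(n)$, $r(X,X^*)$ is defined (the inverse exists) and $r_{x,x^*}(X,X^*)[H,H^*]\succeq 0$ for every $g$-tuple $H$ of $n\times n$ matrices. Let $P$ and $P_*$ be the orthogonal projections of $\mathbb C^d$ onto $\operatorname{ran}B=\sum_j\operatorname{ran}B_j$ and $\operatorname{ran}B^*=\sum_j\operatorname{ran}B_j^*$. (1) If $PKP\succeq 0$ and $P_*KP_*\succeq 0$, then there is an $\varepsilon>0$ such that $r$ is plush on $\mathbb B_\varepsilon$. (2) Suppose the realization is minimal, that is, the vectors $w(B_1K,\dots,B_gK,B_1^*K,\dots,B_g^*K)c$, with $w$ ranging over all words in $2g$ noncommuting letters, span $\mathbb C^d$. Then there is an $\varepsilon>0$ such that $r$ is plush on $\mathbb B_\varepsilon$ if and only if $PKP\succeq 0$ and $P_*KP_*\succeq 0$. -/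

import Mathlib

open scoped Matrix Kronecker Topology ComplexOrder

namespace NCPlush

/-- A `g`-tuple of `n × n` complex matrices. -/
abbrev MatTuple (g n : ℕ) : Type := Fin g → Matrix (Fin n) (Fin n) ℂ

/-- The entrywise adjoint `X* = (X₁*, …, X_g*)` of a tuple. -/
def adj {g n : ℕ} (X : MatTuple g n) : MatTuple g n := fun j => (X j)ᴴ

/-- `Λ_A(X) = ∑ⱼ Aⱼ ⊗ Xⱼ`. -/
def Lam {g d n : ℕ} (A : MatTuple g d) (X : MatTuple g n) :
    Matrix (Fin d × Fin n) (Fin d × Fin n) ℂ :=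
  ∑ j, A j ⊗ₖ X j

/-- The pencil `K ⊗ Iₙ - Λ_B(X) - Λ_{B*}(Y)`, with `Y` in the place of the variable `x*`. -/
def pencil {g d n : ℕ} (K : Matrix (Fin d) (Fin d) ℂ) (B : MatTuple g d)
    (X Y : MatTuple g n) : Matrix (Fin d × Fin n) (Fin d × Fin n) ℂ :=
  K ⊗ₖ (1 : Matrix (Fin n) (Fin n) ℂ) - Lam B X - Lam (adj B) Y

/-- The `dn × n` matrix `c ⊗ Iₙ`, for a column vector `c ∈ ℂᵈ`. -/
def colTensor {d : ℕ} (c : Fin d → ℂ) (n : ℕ) : Matrix (Fin d × Fin n) (Fin n) ℂ :=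
  Matrix.of fun p k => c p.1 * (1 : Matrix (Fin n) (Fin n) ℂ) p.2 k

/-- The value `(c ⊗ Iₙ)* (K ⊗ Iₙ - Λ_B(X) - Λ_{B*}(Y))⁻¹ (c ⊗ Iₙ)` of the symmetric descriptor
realization, with `X` substituted for `x` and `Y` for `x*`; it is meaningful where the pencil is
invertible. The value of `r` at the tuple `X` is `descriptorEval K B c X (adj X)`; keeping `Y`
separate is what gives a meaning to the partial derivatives in `x` and in `x*`. -/
noncomputable def descriptorEval {g d n : ℕ} (K : Matrix (Fin d) (Fin d) ℂ) (B : MatTuple g d)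
    (c : Fin d → ℂ) (X Y : MatTuple g n) : Matrix (Fin n) (Fin n) ℂ :=
  (colTensor c n)ᴴ * (pencil K B X Y)⁻¹ * colTensor c n

/-- `L` is the complex Hessian `f_{x,x*}(X,X*)[H,H*]`: the partial derivatives
`D s = f_x(X,(X+sH)*)[H,H*] = lim_{t → 0} (f(X+tH,(X+sH)*) - f(X,(X+sH)*)) / t`
exist for all small real `s`, and `L = lim_{s → 0} (D s - D 0) / s`. -/
def HasComplexHessianAt {g n : ℕ}
    (f : MatTuple g n → MatTuple g n → Matrix (Fin n) (Fin n) ℂ) (X H : MatTuple g n)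
    (L : Matrix (Fin n) (Fin n) ℂ) : Prop :=
  ∃ D : ℝ → Matrix (Fin n) (Fin n) ℂ,
    (∀ᶠ s in 𝓝 (0 : ℝ), HasDerivAt (fun t : ℝ => f (X + t • H) (adj (X + s • H))) (D s) 0) ∧
    HasDerivAt D L 0

/-- The (column) free ball of radius `ε` around `0`, at level `n`:
the tuples `X` with `∑ⱼ Xⱼ* Xⱼ ≺ ε² Iₙ`. -/
def freeBall (g : ℕ) (ε : ℝ) (n : ℕ) : Set (MatTuple g n) :=
  {X | (((ε : ℂ) ^ 2) • (1 : Matrix (Fin n) (Fin n) ℂ) - ∑ j, (X j)ᴴ * X j).PosDef}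

/-- The realization is plush on `Ω = (Ω(n))ₙ`: at each `X ∈ Ω(n)` it is defined, and its complex
Hessian in each direction `H` is positive semidefinite. -/
def IsPlushOn {g d : ℕ} (K : Matrix (Fin d) (Fin d) ℂ) (B : MatTuple g d) (c : Fin d → ℂ)
    (Ω : ∀ n : ℕ, Set (MatTuple g n)) : Prop :=
  ∀ (n : ℕ), ∀ X ∈ Ω n, IsUnit (pencil K B X (adj X)) ∧
    ∀ H : MatTuple g n, ∃ L : Matrix (Fin n) (Fin n) ℂ,
      HasComplexHessianAt (descriptorEval K B c) X H L ∧ L.PosSemidef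

/-- The realization is minimal: the vectors `w(B₁K, …, B_gK, B₁*K, …, B_g*K) c`, over the words
`w` in `2g` free letters, span `ℂᵈ`. -/
def IsMinimal {g d : ℕ} (K : Matrix (Fin d) (Fin d) ℂ) (B : MatTuple g d)
    (c : Fin d → ℂ) : Prop :=
  Submodule.span ℂ (Set.range fun w : FreeMonoid (Fin g ⊕ Fin g) =>
    FreeMonoid.lift (Sum.elim (fun j => B j * K) (fun j => (B j)ᴴ * K)) w *ᵥ c) = ⊤

/-- `ran E`, the span of the ranges of the `Eⱼ`, in `ℂᵈ` with its Euclidean inner product. -/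
noncomputable def ran {g d : ℕ} (E : MatTuple g d) : Submodule ℂ (EuclideanSpace ℂ (Fin d)) :=
  ⨆ j, LinearMap.range (Matrix.toEuclideanLin (E j))

/-- `P K P ⪰ 0`, where `P` is the orthogonal projection of `ℂᵈ` onto the subspace `S`. -/
def CompressionNonneg {d : ℕ} (K : Matrix (Fin d) (Fin d) ℂ)
    (S : Submodule ℂ (EuclideanSpace ℂ (Fin d))) : Prop :=
  (S.starProjection ∘L Matrix.toEuclideanCLM (n := Fin d) (𝕜 := ℂ) K ∘L
    S.starProjection).IsPositive

end NCPlush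

/-!
Write `A = Λ_B(X)`, `A_H = Λ_B(H)` and `R = (K ⊗ I - A - A*)⁻¹`. Differentiating the inverse twice
gives the complex Hessian in closed form,
`(c ⊗ I)* R (A_H* R A_H + A_H R A_H*) R (c ⊗ I)`
(`hasComplexHessianAt_descriptorEval`), a sum of two terms, each congruent to a compression of `R`:
one to `ran B ⊗ ℂⁿ`, which contains the range of `A_H`, the other to `ran B* ⊗ ℂⁿ`.

*Sufficiency.* Let `v ∈ ran B ⊗ ℂⁿ` and `y = R v`, and put `u = v + A y ∈ ran B ⊗ ℂⁿ`, `b = A* y`.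
Then `y = K (u + b)`, and expanding gives `Re ⟨v, y⟩ = ⟨u, K u⟩ - ⟨b, K b⟩`. Moreover
`b = A* K u + A* K b`, so `b` is controlled by `A* K u` when `A` is small; and `‖A* K u‖²` is
controlled by `⟨u, K u⟩`, by the Cauchy-Schwarz inequality for the form of `K`, which is nonnegative
on `ran B ⊗ ℂⁿ`, at the vectors `u` and `A A* K u`. Hence `⟨v, R v⟩ ≥ 0` as soon as `‖A‖ ≤ 1/4`, a
bound that does not depend on the size of the matrices (`re_inner_pencil_solution_nonneg`). The
same argument with `A` and `A*` exchanged handles `ran B*`.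

*Necessity.* Consider the state vectors `ξ = R (c ⊗ z)`, for all sizes, all small `X` and all `z`,
and the set of linear combinations of their components in `ℂᵈ`. Direct sums of tuples show that it
is a subspace, and that any finite family in it comes from a single `ξ`. It contains `K c`, and it
is invariant under `K Bⱼ` and `K Bⱼ*`: perturb `X ⊕ 0` by a small off-diagonal coupling and look at
the new component (`mulVec_slice_lam_mem_componentSubmodule`). By minimality it is all of `ℂᵈ`
(`componentSubmodule_eq_top`). Therefore each vector of `ran B` has the form `Λ_B(q) ξ` for one
state vector `ξ` and a tuple `q` of rows. The Hessian at `X ⊕ 0` in the direction with the single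
off-diagonal block `q` has, at the vector `z ⊕ 0`, the value `⟨Λ_B(q) ξ, K Λ_B(q) ξ⟩`, because the
pencil at the summand `0` is `K` (`re_form_slice_lam_nonneg`). A direction with the opposite
off-diagonal block gives the vectors of `ran B*`.
-/

namespace NCPlush

/-! ### Definiteness of compressed resolvents -/

section Hilbert

open scoped InnerProductSpace

variable {E : Type*} [NormedAddCommGroup E] [InnerProductSpace ℂ E]

theorem norm_apply_of_involution {K : E →L[ℂ] E} (hKsa : ∀ x y, ⟪K x, y⟫_ℂ = ⟪x, K y⟫_ℂ)
    (hK : ∀ x, K (K x) = x) (x : E) : ‖K x‖ = ‖x‖ := by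
  have h : ‖K x‖ ^ 2 = ‖x‖ ^ 2 := by
    rw [← inner_self_eq_norm_sq (𝕜 := ℂ), ← inner_self_eq_norm_sq (𝕜 := ℂ), hKsa, hK]
  exact (sq_eq_sq₀ (norm_nonneg _) (norm_nonneg _)).1 h

theorem eq_zero_of_pencil_apply_eq_zero {K A A' : E →L[ℂ] E}
    (hKsa : ∀ x y, ⟪K x, y⟫_ℂ = ⟪x, K y⟫_ℂ) (hK : ∀ x, K (K x) = x)
    (hA : ∀ x, ‖A x‖ ≤ 1 / 4 * ‖x‖) (hA' : ∀ x, ‖A' x‖ ≤ 1 / 4 * ‖x‖) {y : E}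
    (hy : K y - A y - A' y = 0) : y = 0 := by
  have h1 : K y = A y + A' y := by
    rw [sub_sub, sub_eq_zero] at hy
    exact hy
  have h2 : ‖y‖ ≤ 1 / 4 * ‖y‖ + 1 / 4 * ‖y‖ := by
    rw [← norm_apply_of_involution hKsa hK y, h1]
    refine (norm_add_le _ _).trans ?_
    rw [← h1, norm_apply_of_involution hKsa hK y]
    exact add_le_add (hA y) (hA' y)
  exact norm_le_zero_iff.1 (by linarith [norm_nonneg y])

/-- If the form of the symmetry `K` is nonnegative on a subspace `S` containing the range of a small
operator `A` with adjoint `A'`, then the compression to `S` of the inverse of `K - A - A'` has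
nonnegative real part. No positivity on the range of `A'` is needed. -/
theorem re_inner_pencil_solution_nonneg {K A A' : E →L[ℂ] E} {S : Submodule ℂ E}
    (hKsa : ∀ x y, ⟪K x, y⟫_ℂ = ⟪x, K y⟫_ℂ) (hK : ∀ x, K (K x) = x)
    (hAA' : ∀ x y, ⟪A x, y⟫_ℂ = ⟪x, A' y⟫_ℂ)
    (hA : ∀ x, ‖A x‖ ≤ 1 / 4 * ‖x‖) (hA' : ∀ x, ‖A' x‖ ≤ 1 / 4 * ‖x‖)
    (hAS : ∀ x, A x ∈ S) (hpos : ∀ u ∈ S, 0 ≤ (⟪u, K u⟫_ℂ).re)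
    {v y : E} (hv : v ∈ S) (hy : K y - A y - A' y = v) : 0 ≤ (⟪v, y⟫_ℂ).re := by
  obtain ⟨u, hu⟩ : ∃ u, u = v + A y := ⟨_, rfl⟩
  obtain ⟨b, hb⟩ : ∃ b, b = A' y := ⟨_, rfl⟩
  have huS : u ∈ S := hu ▸ S.add_mem hv (hAS y)
  have hKy : y = K (u + b) := by
    have h : v + A y + A' y = K y := by rw [← hy]; abel
    rw [hu, hb, h, hK]
  have symm_re : ∀ x z : E, (⟪x, z⟫_ℂ).re = (⟪z, x⟫_ℂ).re := fun x z => by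
    rw [← inner_conj_symm, Complex.conj_re]
  -- The pairing is the difference of the values of the form of `K` at `u` and at `b`.
  have hform : (⟪v, y⟫_ℂ).re = (⟪u, K u⟫_ℂ).re - (⟪b, K b⟫_ℂ).re := by
    have h1 : v = u - A y := by rw [hu, add_sub_cancel_right]
    have h2 : (⟪A y, y⟫_ℂ).re = (⟪b, y⟫_ℂ).re := by rw [hAA', ← hb, symm_re]
    have h3 : (⟪u, K b⟫_ℂ).re = (⟪b, K u⟫_ℂ).re := by rw [← hKsa, symm_re]
    rw [h1, inner_sub_left, Complex.sub_re, h2, hKy, map_add, inner_add_right, inner_add_right,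
      Complex.add_re, Complex.add_re, h3]
    ring
  have hbb : (⟪b, K b⟫_ℂ).re ≤ ‖b‖ ^ 2 := by
    refine (Complex.re_le_norm _).trans ((norm_inner_le_norm _ _).trans ?_)
    rw [norm_apply_of_involution hKsa hK, sq]
  have hb2 : ‖b‖ ≤ 2 * ‖A' (K u)‖ := by
    have h1 : b = A' (K u) + A' (K b) := by rw [← map_add, ← map_add, ← hKy, hb]
    have h2 : ‖b‖ ≤ ‖A' (K u)‖ + 1 / 4 * ‖b‖ := by
      calc ‖b‖ = ‖A' (K u) + A' (K b)‖ := by rw [← h1]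
        _ ≤ _ := (norm_add_le _ _).trans (by
          have := hA' (K b)
          rw [norm_apply_of_involution hKsa hK] at this
          linarith)
    linarith [norm_nonneg b, norm_nonneg (A' (K u))]
  -- Positivity of the form of `K` at `u - 4 A A* K u`, which lies in `S`, bounds `A* K u`.
  have hmain : 4 * ‖A' (K u)‖ ^ 2 ≤ (⟪u, K u⟫_ℂ).re := by
    obtain ⟨a, ha⟩ : ∃ a, a = A (A' (K u)) := ⟨_, rfl⟩
    have haS : a ∈ S := ha ▸ hAS _
    have h1 : 0 ≤ (⟪u - (4 : ℂ) • a, K (u - (4 : ℂ) • a)⟫_ℂ).re :=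
      hpos _ (S.sub_mem huS (S.smul_mem _ haS))
    have h2 : (⟪a, K u⟫_ℂ).re = ‖A' (K u)‖ ^ 2 := by
      rw [ha, hAA', ← inner_self_eq_norm_sq (𝕜 := ℂ)]
      rfl
    have h3 : (⟪u, K a⟫_ℂ).re = ‖A' (K u)‖ ^ 2 := by
      rw [← h2, ← hKsa, symm_re]
    have h4 : (⟪a, K a⟫_ℂ).re ≤ 1 / 16 * ‖A' (K u)‖ ^ 2 := by
      refine (Complex.re_le_norm _).trans ((norm_inner_le_norm _ _).trans ?_)
      rw [norm_apply_of_involution hKsa hK]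
      have := hA (A' (K u))
      rw [← ha] at this
      nlinarith [norm_nonneg a]
    have h5 : (⟪u - (4 : ℂ) • a, K (u - (4 : ℂ) • a)⟫_ℂ).re =
        (⟪u, K u⟫_ℂ).re - 4 * (⟪u, K a⟫_ℂ).re - 4 * (⟪a, K u⟫_ℂ).re
          + 16 * (⟪a, K a⟫_ℂ).re := by
      simp only [map_sub, map_smul, inner_sub_left, inner_sub_right, inner_smul_left,
        inner_smul_right, Complex.sub_re, Complex.mul_re, map_ofNat,
        Complex.re_ofNat, Complex.im_ofNat]
      ring
    rw [h5, h2, h3] at h1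
    linarith [sq_nonneg ‖A' (K u)‖]
  rw [hform]
  nlinarith [norm_nonneg b, norm_nonneg (A' (K u))]

end Hilbert

/-! ### The derivative of a resolvent -/

section Derivative

variable {𝔸 : Type*} [NormedRing 𝔸] [NormedAlgebra ℝ 𝔸] [CompleteSpace 𝔸]

/-- The derivative at `t = 0` of `(M - t A)⁻¹` is `M⁻¹ A M⁻¹`. -/
theorem hasDerivAt_ringInverse_sub_smul {M : 𝔸} (hM : IsUnit M) (A : 𝔸) :
    HasDerivAt (fun t : ℝ => Ring.inverse (M - t • A))
      (Ring.inverse M * A * Ring.inverse M) 0 := by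
  obtain ⟨u, rfl⟩ := hM
  have h1 : HasDerivAt (fun t : ℝ => (u : 𝔸) - t • A) (-A) 0 := by
    simpa using ((hasDerivAt_id (0 : ℝ)).smul_const A).const_sub (u : 𝔸)
  have h2 : HasFDerivAt Ring.inverse (-ContinuousLinearMap.mulLeftRight ℝ 𝔸 ↑u⁻¹ ↑u⁻¹)
      ((u : 𝔸) - (0 : ℝ) • A) := by
    rw [zero_smul, sub_zero]
    exact hasFDerivAt_ringInverse u
  have h3 := h2.comp_hasDerivAt (0 : ℝ) h1
  simpa [Function.comp_def] using h3

end Derivative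

/-! ### Slices of tensors and operator norms -/

section Slice

variable {d ι κ : Type*}

/-- The `i`-th component, in `ℂᵈ`, of a vector of `ℂᵈ ⊗ ℂ^ι`. -/
def slice (v : d × ι → ℂ) (i : ι) : d → ℂ := fun a => v (a, i)

theorem slice_add (v w : d × ι → ℂ) (i : ι) : slice (v + w) i = slice v i + slice w i := rfl

theorem slice_kronecker_mulVec [Fintype d] [Fintype κ] (A : Matrix d d ℂ) (X : Matrix ι κ ℂ)
    (v : d × κ → ℂ) (i : ι) :
    slice ((A ⊗ₖ X) *ᵥ v) i = ∑ k, X i k • (A *ᵥ slice v k) := by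
  ext a
  simp only [slice, Matrix.mulVec, dotProduct, Matrix.kroneckerMap_apply, Fintype.sum_prod_type,
    Finset.sum_apply, Pi.smul_apply, smul_eq_mul, Finset.mul_sum]
  rw [Finset.sum_comm]
  exact Finset.sum_congr rfl fun k _ => Finset.sum_congr rfl fun b _ => by ring

theorem slice_one_kronecker_mulVec [Fintype d] [Fintype ι] [DecidableEq ι] (A : Matrix d d ℂ)
    (v : d × ι → ℂ) (i : ι) :
    slice ((A ⊗ₖ (1 : Matrix ι ι ℂ)) *ᵥ v) i = A *ᵥ slice v i := by
  simp [slice_kronecker_mulVec, Matrix.one_apply, ite_smul]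

theorem star_dotProduct_eq_sum_slice [Fintype d] [Fintype ι] (v w : d × ι → ℂ) :
    star v ⬝ᵥ w = ∑ i, star (slice v i) ⬝ᵥ slice w i := by
  simp only [dotProduct, Fintype.sum_prod_type, slice, Pi.star_apply]
  exact Finset.sum_comm

end Slice

section Norm

open scoped Matrix.Norms.L2Operator

variable {m n : Type*} [Fintype m] [Fintype n]

theorem norm_toLp_sq (x : n → ℂ) : ‖WithLp.toLp 2 x‖ ^ 2 = (star x ⬝ᵥ x).re := by
  rw [← inner_self_eq_norm_sq (𝕜 := ℂ), EuclideanSpace.inner_toLp_toLp, dotProduct_comm]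
  rfl

theorem star_dotProduct_gram_mulVec (A : Matrix m n ℂ) (x : n → ℂ) :
    (star x ⬝ᵥ (Aᴴ * A) *ᵥ x).re = ‖WithLp.toLp 2 (A *ᵥ x)‖ ^ 2 := by
  rw [norm_toLp_sq, ← Matrix.mulVec_mulVec, Matrix.dotProduct_mulVec, ← Matrix.star_mulVec]

variable [DecidableEq n]

theorem l2_opNorm_le_of_forall {A : Matrix m n ℂ} {C : ℝ} (hC : 0 ≤ C)
    (h : ∀ x : n → ℂ, ‖WithLp.toLp 2 (A *ᵥ x)‖ ^ 2 ≤ C ^ 2 * ‖WithLp.toLp 2 x‖ ^ 2) :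
    ‖A‖ ≤ C := by
  rw [Matrix.l2_opNorm_def]
  refine ContinuousLinearMap.opNorm_le_bound _ hC fun x => ?_
  have := h x.ofLp
  rw [← mul_pow] at this
  exact le_of_sq_le_sq this (by positivity)

theorem norm_sq_toLp_mulVec_le (A : Matrix m n ℂ) (x : n → ℂ) :
    ‖WithLp.toLp 2 (A *ᵥ x)‖ ^ 2 ≤ ‖A‖ ^ 2 * ‖WithLp.toLp 2 x‖ ^ 2 := by
  rw [← mul_pow]
  exact pow_le_pow_left₀ (norm_nonneg _) (A.l2_opNorm_mulVec (WithLp.toLp 2 x)) 2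

theorem norm_kronecker_le {d : Type*} [Fintype d] [DecidableEq d] (A : Matrix d d ℂ)
    (X : Matrix n n ℂ) : ‖A ⊗ₖ X‖ ≤ ‖A‖ * ‖X‖ := by
  have hsq : ∀ v : d × n → ℂ, ‖WithLp.toLp 2 v‖ ^ 2 = ∑ a, ∑ i, ‖v (a, i)‖ ^ 2 := fun v => by
    rw [EuclideanSpace.norm_sq_eq, Fintype.sum_prod_type]
  have h1 : ‖A ⊗ₖ (1 : Matrix n n ℂ)‖ ≤ ‖A‖ := by
    refine l2_opNorm_le_of_forall (norm_nonneg _) fun v => ?_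
    rw [hsq, hsq, Finset.sum_comm, Finset.sum_comm (f := fun a i => ‖v (a, i)‖ ^ 2),
      Finset.mul_sum]
    refine Finset.sum_le_sum fun i _ => ?_
    have h := norm_sq_toLp_mulVec_le A (slice v i)
    rw [← slice_one_kronecker_mulVec, EuclideanSpace.norm_sq_eq, EuclideanSpace.norm_sq_eq] at h
    exact h
  have h2 : ‖(1 : Matrix d d ℂ) ⊗ₖ X‖ ≤ ‖X‖ := by
    refine l2_opNorm_le_of_forall (norm_nonneg _) fun v => ?_
    rw [hsq, hsq, Finset.mul_sum]
    refine Finset.sum_le_sum fun a _ => ?_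
    have h := norm_sq_toLp_mulVec_le X (fun i => v (a, i))
    rw [EuclideanSpace.norm_sq_eq, EuclideanSpace.norm_sq_eq] at h
    have h3 : ∀ i, ((1 : Matrix d d ℂ) ⊗ₖ X *ᵥ v) (a, i) = (X *ᵥ fun k => v (a, k)) i := by
      intro i
      change slice (((1 : Matrix d d ℂ) ⊗ₖ X) *ᵥ v) i a = _
      rw [slice_kronecker_mulVec]
      simp [Matrix.mulVec, dotProduct, slice]
    simpa only [h3] using h
  calc ‖A ⊗ₖ X‖ = ‖(A ⊗ₖ (1 : Matrix n n ℂ)) * ((1 : Matrix d d ℂ) ⊗ₖ X)‖ := by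
        rw [← Matrix.mul_kronecker_mul, mul_one, one_mul]
    _ ≤ ‖A‖ * ‖X‖ := (norm_mul_le _ _).trans (mul_le_mul h1 h2 (norm_nonneg _) (norm_nonneg _))

/-- Membership in the column ball in terms of norms of vectors. -/
theorem posDef_smul_one_sub_sum_gram_iff {g : ℕ} (r : ℝ) (X : Fin g → Matrix n n ℂ) :
    ((((r : ℂ) ^ 2) • (1 : Matrix n n ℂ) - ∑ j, (X j)ᴴ * X j).PosDef) ↔
      ∀ x : n → ℂ, x ≠ 0 →
        ∑ j, ‖WithLp.toLp 2 (X j *ᵥ x)‖ ^ 2 < r ^ 2 * ‖WithLp.toLp 2 x‖ ^ 2 := by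
  have hH : (((r : ℂ) ^ 2) • (1 : Matrix n n ℂ) - ∑ j, (X j)ᴴ * X j).IsHermitian := by
    refine Matrix.IsHermitian.sub ?_ ?_
    · rw [Matrix.IsHermitian, Matrix.conjTranspose_smul, Matrix.conjTranspose_one]
      simp
    · rw [Matrix.IsHermitian, Matrix.conjTranspose_sum]
      exact Finset.sum_congr rfl fun j _ => Matrix.isHermitian_conjTranspose_mul_self (X j)
  have hre : ∀ x : n → ℂ,
      (star x ⬝ᵥ (((r : ℂ) ^ 2) • (1 : Matrix n n ℂ) - ∑ j, (X j)ᴴ * X j) *ᵥ x).re =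
        r ^ 2 * ‖WithLp.toLp 2 x‖ ^ 2 - ∑ j, ‖WithLp.toLp 2 (X j *ᵥ x)‖ ^ 2 := by
    intro x
    rw [Matrix.sub_mulVec, dotProduct_sub, Complex.sub_re, Matrix.smul_mulVec,
      Matrix.one_mulVec, dotProduct_smul, Matrix.sum_mulVec, dotProduct_sum, Complex.re_sum,
      norm_toLp_sq, smul_eq_mul, ← Complex.ofReal_pow, Complex.re_ofReal_mul]
    simp only [star_dotProduct_gram_mulVec]
  rw [Matrix.posDef_iff_dotProduct_mulVec]
  constructor
  · rintro ⟨-, h⟩ x hx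
    have := (Complex.lt_def.1 (h hx)).1
    rw [hre] at this
    simpa using this
  · refine fun h => ⟨hH, fun x hx => Complex.lt_def.2 ⟨?_, ?_⟩⟩
    · rw [hre]
      simpa using h x hx
    · exact (hH.im_star_dotProduct_mulVec_self x).symm

end Norm

/-! ### The pencil over an arbitrary finite index type -/

section Pencil

variable {g d : ℕ} {ι κ : Type*}

/-- `Λ_A(X) = ∑ⱼ Aⱼ ⊗ Xⱼ` for a tuple of rectangular matrices `Xⱼ` with arbitrary index types. -/
def lam (A : MatTuple g d) (X : Fin g → Matrix ι κ ℂ) : Matrix (Fin d × ι) (Fin d × κ) ℂ :=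
  ∑ j, A j ⊗ₖ X j

/-- The hermitian pencil `K ⊗ I - Λ_B(X) - Λ_B(X)*`, for an arbitrary index type. -/
def hermPencil [DecidableEq ι] (K : Matrix (Fin d) (Fin d) ℂ) (B : MatTuple g d)
    (X : Fin g → Matrix ι ι ℂ) : Matrix (Fin d × ι) (Fin d × ι) ℂ :=
  K ⊗ₖ (1 : Matrix ι ι ℂ) - lam B X - (lam B X)ᴴ

/-- The vector `c ⊗ z`. -/
def tensorVec (c : Fin d → ℂ) (z : ι → ℂ) : Fin d × ι → ℂ := fun p => c p.1 * z p.2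

theorem lam_conjTranspose (A : MatTuple g d) (X : Fin g → Matrix ι κ ℂ) :
    (lam A X)ᴴ = lam (adj A) (fun j => (X j)ᴴ) := by
  simp only [lam, adj, Matrix.conjTranspose_sum, Matrix.conjTranspose_kronecker]

theorem lam_add (A : MatTuple g d) (X Y : Fin g → Matrix ι κ ℂ) :
    lam A (X + Y) = lam A X + lam A Y := by
  simp only [lam, Pi.add_apply, Matrix.kronecker_add, Finset.sum_add_distrib]

@[simp]
theorem lam_zero (A : MatTuple g d) : lam A (0 : Fin g → Matrix ι κ ℂ) = 0 := by
  simp [lam]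

theorem lam_real_smul (A : MatTuple g d) (t : ℝ) (X : Fin g → Matrix ι κ ℂ) :
    lam A (t • X) = t • lam A X := by
  simp only [lam, Pi.smul_apply, Matrix.kronecker_smul, Finset.smul_sum]

theorem hermPencil_isHermitian [DecidableEq ι] {K : Matrix (Fin d) (Fin d) ℂ}
    (hKsa : K.IsHermitian) (B : MatTuple g d) (X : Fin g → Matrix ι ι ℂ) :
    (hermPencil K B X).IsHermitian := by
  rw [Matrix.IsHermitian, hermPencil, Matrix.conjTranspose_sub, Matrix.conjTranspose_sub,
    Matrix.conjTranspose_conjTranspose, Matrix.conjTranspose_kronecker, hKsa.eq,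
    Matrix.conjTranspose_one, sub_right_comm]

theorem pencil_adj {n : ℕ} (K : Matrix (Fin d) (Fin d) ℂ) (B : MatTuple g d) (X : MatTuple g n) :
    pencil K B X (adj X) = hermPencil K B X := by
  rw [hermPencil, lam_conjTranspose]
  rfl

theorem pencil_add_smul {n : ℕ} (K : Matrix (Fin d) (Fin d) ℂ) (B : MatTuple g d)
    (X H : MatTuple g n) (s t : ℝ) :
    pencil K B (X + t • H) (adj (X + s • H)) =
      hermPencil K B X - s • (lam B H)ᴴ - t • lam B H := by
  have h1 : adj (X + s • H) = (fun j => (X j)ᴴ) + s • (fun j => (H j)ᴴ) := by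
    ext1 j
    simp [adj, Matrix.conjTranspose_add, Matrix.conjTranspose_smul]
  have h2 : pencil K B (X + t • H) (adj (X + s • H)) =
    K ⊗ₖ (1 : Matrix (Fin n) (Fin n) ℂ) - lam B (X + t • H) - lam (adj B) (adj (X + s • H)) := rfl
  rw [h2, h1, lam_add, lam_add, lam_real_smul, lam_real_smul, ← lam_conjTranspose,
    ← lam_conjTranspose, hermPencil]
  abel

theorem colTensor_mulVec {n : ℕ} (c : Fin d → ℂ) (z : Fin n → ℂ) :
    colTensor c n *ᵥ z = tensorVec c z := by
  ext p
  simp [colTensor, tensorVec, Matrix.mulVec, dotProduct, Matrix.one_apply]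

theorem slice_lam_mulVec [Fintype κ] (A : MatTuple g d) (X : Fin g → Matrix ι κ ℂ)
    (v : Fin d × κ → ℂ) (i : ι) :
    slice (lam A X *ᵥ v) i = ∑ j, A j *ᵥ (∑ k, X j i k • slice v k) := by
  have h : slice (lam A X *ᵥ v) i = ∑ j, slice ((A j ⊗ₖ X j) *ᵥ v) i := by
    ext a
    simp [slice, lam, Matrix.sum_mulVec]
  rw [h]
  refine Finset.sum_congr rfl fun j _ => ?_
  rw [slice_kronecker_mulVec, Matrix.mulVec_sum]
  simp only [Matrix.mulVec_smul]

end Pencil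

/-! ### The complex Hessian of a descriptor realization -/

section Hessian

variable {g d n : ℕ}

/-- The complex Hessian of the realization at `X` in the direction `H`, in closed form:
`(c ⊗ I)* R (Λ_B(H)* R Λ_B(H) + Λ_B(H) R Λ_B(H)*) R (c ⊗ I)` with `R` the inverse of the pencil. -/
noncomputable def hessian (K : Matrix (Fin d) (Fin d) ℂ) (B : MatTuple g d) (c : Fin d → ℂ)
    (X H : MatTuple g n) : Matrix (Fin n) (Fin n) ℂ :=
  (colTensor c n)ᴴ * ((hermPencil K B X)⁻¹ * ((lam B H)ᴴ * (hermPencil K B X)⁻¹ * lam B H +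
    lam B H * (hermPencil K B X)⁻¹ * (lam B H)ᴴ) * (hermPencil K B X)⁻¹) * colTensor c n

section

open scoped Matrix.Norms.L2Operator

theorem hasComplexHessianAt_descriptorEval {K : Matrix (Fin d) (Fin d) ℂ} {B : MatTuple g d}
    {X : MatTuple g n} (hX : IsUnit (hermPencil K B X)) (c : Fin d → ℂ) (H : MatTuple g n) :
    HasComplexHessianAt (descriptorEval K B c) X H (hessian K B c X H) := by
  obtain ⟨M, hM⟩ : ∃ M, M = hermPencil K B X := ⟨_, rfl⟩
  obtain ⟨A, hA⟩ : ∃ A, A = lam B H := ⟨_, rfl⟩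
  obtain ⟨C, hC⟩ : ∃ C, C = colTensor c n := ⟨_, rfl⟩
  let N : ℝ → Matrix (Fin d × Fin n) (Fin d × Fin n) ℂ := fun s => M - s • Aᴴ
  have hN : ContinuousAt N 0 := by fun_prop
  have hunit : ∀ᶠ s in 𝓝 (0 : ℝ), IsUnit (N s) := by
    refine hN.eventually_mem (Units.isOpen.mem_nhds ?_)
    simpa [N, hM] using hX
  have heval : ∀ s t : ℝ, descriptorEval K B c (X + t • H) (adj (X + s • H)) =
      Cᴴ * Ring.inverse (N s - t • A) * C := fun s t => by
    rw [descriptorEval, pencil_add_smul, Matrix.nonsing_inv_eq_ringInverse, hC, hA]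
    simp only [N, hM, hA]
  have conj_deriv : ∀ (f : ℝ → Matrix (Fin d × Fin n) (Fin d × Fin n) ℂ) f',
      HasDerivAt f f' 0 → HasDerivAt (fun t => Cᴴ * f t * C) (Cᴴ * f' * C) 0 := by
    intro f f' hf
    let Φ : Matrix (Fin d × Fin n) (Fin d × Fin n) ℂ →ₗ[ℝ] Matrix (Fin n) (Fin n) ℂ :=
      { toFun := fun Z => Cᴴ * Z * C
        map_add' := fun Z W => by rw [Matrix.mul_add, Matrix.add_mul]
        map_smul' := fun r Z => by simp }
    exact (LinearMap.toContinuousLinearMap Φ).hasFDerivAt.comp_hasDerivAt (0 : ℝ) hf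
  refine ⟨fun s => Cᴴ * (Ring.inverse (N s) * A * Ring.inverse (N s)) * C, ?_, ?_⟩
  · filter_upwards [hunit] with s hs
    simp only [heval]
    exact conj_deriv _ _ (hasDerivAt_ringInverse_sub_smul hs A)
  · have h0 : IsUnit M := hM ▸ hX
    have h1 := hasDerivAt_ringInverse_sub_smul h0 Aᴴ
    have h2 := conj_deriv _ _ ((h1.mul_const A).mul h1)
    refine h2.congr_deriv ?_
    simp only [hessian, ← hM, ← hA, ← hC, Matrix.nonsing_inv_eq_ringInverse, zero_smul, sub_zero]
    noncomm_ring

end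

end Hessian

/-! ### Sufficiency: nonnegative compressions give a plush realization -/

section Sufficiency

open scoped Matrix.Norms.L2Operator InnerProductSpace

theorem posSemidef_conj_of_re_nonneg {m n : Type*} [Fintype m] [Fintype n] {R : Matrix n n ℂ}
    (hR : R.IsHermitian) (M : Matrix n m ℂ)
    (h : ∀ z, 0 ≤ (star (M *ᵥ z) ⬝ᵥ R *ᵥ (M *ᵥ z)).re) : (Mᴴ * R * M).PosSemidef := by
  have hH : (Mᴴ * R * M).IsHermitian := Matrix.isHermitian_conjTranspose_mul_mul M hR
  refine Matrix.PosSemidef.of_dotProduct_mulVec_nonneg hH fun z => Complex.le_def.2 ⟨?_, ?_⟩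
  · have := h z
    rw [Matrix.star_mulVec, ← Matrix.dotProduct_mulVec, Matrix.mulVec_mulVec,
      Matrix.mulVec_mulVec] at this
    exact this
  · exact (hH.im_star_dotProduct_mulVec_self z).symm

section Resolvent

variable {n : Type*} [Fintype n] [DecidableEq n]

theorem inner_toEuclideanCLM_eq_inner {A B : Matrix n n ℂ} (h : Aᴴ = B) (x y : EuclideanSpace ℂ n) :
    ⟪Matrix.toEuclideanCLM (𝕜 := ℂ) A x, y⟫_ℂ = ⟪x, Matrix.toEuclideanCLM (𝕜 := ℂ) B y⟫_ℂ := by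
  subst h
  have h : Matrix.toEuclideanCLM (𝕜 := ℂ) Aᴴ =
      ContinuousLinearMap.adjoint (Matrix.toEuclideanCLM (𝕜 := ℂ) A) :=
    map_star (Matrix.toEuclideanCLM (𝕜 := ℂ)) A
  rw [h, ContinuousLinearMap.adjoint_inner_right]

/-- The matrix form of `eq_zero_of_pencil_apply_eq_zero` and `re_inner_pencil_solution_nonneg`. -/
theorem isUnit_and_inv_nonneg_of_compression {K A : Matrix n n ℂ} (hK : K * K = 1)
    (hKsa : K.IsHermitian) (hA : ‖A‖ ≤ 1 / 4) {S : Submodule ℂ (EuclideanSpace ℂ n)}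
    (hAS : ∀ x : n → ℂ, WithLp.toLp 2 (A *ᵥ x) ∈ S)
    (hpos : ∀ u : n → ℂ, WithLp.toLp 2 u ∈ S → 0 ≤ (star u ⬝ᵥ K *ᵥ u).re) :
    IsUnit (K - A - Aᴴ) ∧
      ∀ v : n → ℂ, WithLp.toLp 2 v ∈ S → 0 ≤ (star v ⬝ᵥ (K - A - Aᴴ)⁻¹ *ᵥ v).re := by
  have hK' : ∀ x, Matrix.toEuclideanCLM (𝕜 := ℂ) K (Matrix.toEuclideanCLM (𝕜 := ℂ) K x) = x := by
    intro x
    rw [← mul_apply_eq_comp, ← map_mul, hK, map_one]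
    rfl
  have hA1 : ∀ x, ‖Matrix.toEuclideanCLM (𝕜 := ℂ) A x‖ ≤ 1 / 4 * ‖x‖ := fun x =>
    (ContinuousLinearMap.le_opNorm _ x).trans (mul_le_mul_of_nonneg_right hA (norm_nonneg x))
  have hA2 : ∀ x, ‖Matrix.toEuclideanCLM (𝕜 := ℂ) Aᴴ x‖ ≤ 1 / 4 * ‖x‖ := fun x =>
    (ContinuousLinearMap.le_opNorm _ x).trans (mul_le_mul_of_nonneg_right
      ((Matrix.l2_opNorm_conjTranspose A).le.trans hA) (norm_nonneg x))
  have hM : ∀ y : n → ℂ, Matrix.toEuclideanCLM (𝕜 := ℂ) K (WithLp.toLp 2 y) -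
      Matrix.toEuclideanCLM (𝕜 := ℂ) A (WithLp.toLp 2 y) -
      Matrix.toEuclideanCLM (𝕜 := ℂ) Aᴴ (WithLp.toLp 2 y) =
        WithLp.toLp 2 ((K - A - Aᴴ) *ᵥ y) := fun y => by
    rw [← Matrix.toEuclideanCLM_toLp, map_sub, map_sub]
    rfl
  have hunit : IsUnit (K - A - Aᴴ) := by
    rw [← Matrix.mulVec_injective_iff_isUnit]
    refine (injective_iff_map_eq_zero (Matrix.mulVecLin (K - A - Aᴴ))).2 fun y hy => ?_
    have := eq_zero_of_pencil_apply_eq_zero (inner_toEuclideanCLM_eq_inner hKsa.eq) hK' hA1 hA2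
      (y := WithLp.toLp 2 y) (by
        rw [hM]
        exact (WithLp.toLp_eq_zero 2).2 hy)
    exact (WithLp.toLp_eq_zero 2).1 this
  refine ⟨hunit, fun v hv => ?_⟩
  have h := re_inner_pencil_solution_nonneg (S := S) (inner_toEuclideanCLM_eq_inner hKsa.eq) hK'
    (inner_toEuclideanCLM_eq_inner rfl) hA1 hA2 (fun x => hAS x.ofLp) (fun u hu => by
      have := hpos u.ofLp hu
      rw [dotProduct_comm] at this
      exact this) hv (y := WithLp.toLp 2 ((K - A - Aᴴ)⁻¹ *ᵥ v)) (by
      rw [hM, Matrix.mulVec_mulVec,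
        Matrix.mul_nonsing_inv _ ((Matrix.isUnit_iff_isUnit_det _).1 hunit), Matrix.one_mulVec])
  rw [EuclideanSpace.inner_toLp_toLp, dotProduct_comm] at h
  exact h

end Resolvent

variable {g d : ℕ}

theorem compressionNonneg_iff {K : Matrix (Fin d) (Fin d) ℂ} (hKsa : K.IsHermitian)
    (S : Submodule ℂ (EuclideanSpace ℂ (Fin d))) :
    CompressionNonneg K S ↔
      ∀ v : Fin d → ℂ, WithLp.toLp 2 v ∈ S → 0 ≤ (star v ⬝ᵥ K *ᵥ v).re := by
  have hform : ∀ x, (S.starProjection ∘L Matrix.toEuclideanCLM (n := Fin d) (𝕜 := ℂ) K ∘L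
      S.starProjection).reApplyInnerSelf x =
      (star (S.starProjection x).ofLp ⬝ᵥ K *ᵥ (S.starProjection x).ofLp).re := by
    intro x
    rw [ContinuousLinearMap.reApplyInnerSelf_apply, ContinuousLinearMap.comp_apply,
      ContinuousLinearMap.comp_apply, Submodule.inner_starProjection_left_eq_right,
      inner_toEuclideanCLM_eq_inner hKsa.eq, EuclideanSpace.inner_eq_star_dotProduct,
      dotProduct_comm]
    rfl
  rw [CompressionNonneg, ContinuousLinearMap.isPositive_def]
  constructor
  · rintro ⟨-, h⟩ v hv
    have := h (WithLp.toLp 2 v)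
    rwa [hform, Submodule.starProjection_eq_self_iff.2 hv] at this
  · refine fun h => ⟨fun x y => ?_, fun x => ?_⟩
    · simp only [ContinuousLinearMap.coe_coe, ContinuousLinearMap.comp_apply]
      rw [Submodule.inner_starProjection_left_eq_right, inner_toEuclideanCLM_eq_inner hKsa.eq,
        Submodule.inner_starProjection_left_eq_right]
    · rw [hform]
      exact h _ (Submodule.starProjection_apply_mem S x)

/-- The subspace `S ⊗ ℂ^ι` of `ℂᵈ ⊗ ℂ^ι`: the vectors all of whose slices lie in `S`. -/
def sliceSubmodule (S : Submodule ℂ (EuclideanSpace ℂ (Fin d))) (ι : Type*) :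
    Submodule ℂ (EuclideanSpace ℂ (Fin d × ι)) where
  carrier := {v | ∀ i, WithLp.toLp 2 (slice v.ofLp i) ∈ S}
  add_mem' hv hw i := S.add_mem (hv i) (hw i)
  zero_mem' _ := S.zero_mem
  smul_mem' r _ hv i := S.smul_mem r (hv i)

theorem mulVec_mem_ran (A : MatTuple g d) (j : Fin g) (x : Fin d → ℂ) :
    WithLp.toLp 2 (A j *ᵥ x) ∈ ran A :=
  Submodule.mem_iSup_of_mem j ⟨WithLp.toLp 2 x, rfl⟩

theorem lam_mulVec_mem_sliceSubmodule {ι κ : Type*} [Fintype κ] (A : MatTuple g d)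
    (X : Fin g → Matrix ι κ ℂ) (x : Fin d × κ → ℂ) :
    WithLp.toLp 2 (lam A X *ᵥ x) ∈ sliceSubmodule (ran A) ι := by
  intro i
  change WithLp.toLp 2 (slice (lam A X *ᵥ x) i) ∈ ran A
  rw [slice_lam_mulVec, WithLp.toLp_sum]
  exact Submodule.sum_mem _ fun j _ => mulVec_mem_ran A j _

theorem re_dotProduct_kronecker_one_nonneg {ι : Type*} [Fintype ι] [DecidableEq ι]
    {K : Matrix (Fin d) (Fin d) ℂ} (hKsa : K.IsHermitian)
    {S : Submodule ℂ (EuclideanSpace ℂ (Fin d))} (hS : CompressionNonneg K S)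
    (u : Fin d × ι → ℂ) (hu : WithLp.toLp 2 u ∈ sliceSubmodule S ι) :
    0 ≤ (star u ⬝ᵥ (K ⊗ₖ (1 : Matrix ι ι ℂ)) *ᵥ u).re := by
  rw [star_dotProduct_eq_sum_slice, Complex.re_sum]
  refine Finset.sum_nonneg fun i _ => ?_
  rw [slice_one_kronecker_mulVec]
  exact (compressionNonneg_iff hKsa S).1 hS _ (hu i)

theorem norm_le_of_mem_freeBall {n : ℕ} {ε : ℝ} (hε : 0 ≤ ε) {X : MatTuple g n}
    (hX : X ∈ freeBall g ε n) (j : Fin g) : ‖X j‖ ≤ ε := by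
  refine l2_opNorm_le_of_forall hε fun x => ?_
  by_cases hx : x = 0
  · simp [hx]
  · exact (Finset.single_le_sum (f := fun j => ‖WithLp.toLp 2 (X j *ᵥ x)‖ ^ 2)
      (fun _ _ => sq_nonneg _) (Finset.mem_univ j)).trans
      ((posDef_smul_one_sub_sum_gram_iff ε X).1 hX x hx).le

theorem norm_lam_le {n : ℕ} (B : MatTuple g d) {ε : ℝ} {X : MatTuple g n}
    (hX : ∀ j, ‖X j‖ ≤ ε) : ‖lam B X‖ ≤ (∑ j, ‖B j‖) * ε := by
  rw [lam, Finset.sum_mul]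
  exact (norm_sum_le _ _).trans (Finset.sum_le_sum fun j _ =>
    (norm_kronecker_le (B j) (X j)).trans (mul_le_mul_of_nonneg_left (hX j) (norm_nonneg _)))

theorem hessian_eq_add_conj {n : ℕ} {K : Matrix (Fin d) (Fin d) ℂ} (hKsa : K.IsHermitian)
    (B : MatTuple g d) (c : Fin d → ℂ) (X H : MatTuple g n) :
    hessian K B c X H =
      (lam B H * (hermPencil K B X)⁻¹ * colTensor c n)ᴴ * (hermPencil K B X)⁻¹ *
          (lam B H * (hermPencil K B X)⁻¹ * colTensor c n) +
        ((lam B H)ᴴ * (hermPencil K B X)⁻¹ * colTensor c n)ᴴ * (hermPencil K B X)⁻¹ *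
          ((lam B H)ᴴ * (hermPencil K B X)⁻¹ * colTensor c n) := by
  have hRH : (hermPencil K B X)⁻¹.IsHermitian := (hermPencil_isHermitian hKsa B X).inv
  simp only [hessian, Matrix.conjTranspose_mul, Matrix.conjTranspose_conjTranspose, hRH.eq,
    Matrix.mul_add, Matrix.add_mul, Matrix.mul_assoc]

theorem exists_isPlushOn_freeBall {K : Matrix (Fin d) (Fin d) ℂ} (hK : K * K = 1)
    (hKsa : K.IsHermitian) (B : MatTuple g d) (c : Fin d → ℂ)
    (h1 : CompressionNonneg K (ran B)) (h2 : CompressionNonneg K (ran (adj B))) :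
    ∃ ε : ℝ, 0 < ε ∧ IsPlushOn K B c (freeBall g ε) := by
  have hβ : 0 ≤ ∑ j, ‖B j‖ := Finset.sum_nonneg fun _ _ => norm_nonneg _
  refine ⟨1 / (4 * (∑ j, ‖B j‖ + 1)), by positivity, fun n X hX => ?_⟩
  have hA : ‖lam B X‖ ≤ 1 / 4 := by
    refine (norm_lam_le B (norm_le_of_mem_freeBall (by positivity) hX)).trans ?_
    rw [mul_one_div, div_le_div_iff₀ (by positivity) (by norm_num)]
    linarith
  have hK1 : (K ⊗ₖ (1 : Matrix (Fin n) (Fin n) ℂ)) * (K ⊗ₖ (1 : Matrix (Fin n) (Fin n) ℂ)) = 1 := by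
    rw [← Matrix.mul_kronecker_mul, hK, one_mul, Matrix.one_kronecker_one]
  have hK2 : (K ⊗ₖ (1 : Matrix (Fin n) (Fin n) ℂ)).IsHermitian := by
    rw [Matrix.IsHermitian, Matrix.conjTranspose_kronecker, hKsa.eq, Matrix.conjTranspose_one]
  obtain ⟨hunit, hR1⟩ := isUnit_and_inv_nonneg_of_compression hK1 hK2 hA
    (lam_mulVec_mem_sliceSubmodule B X) (re_dotProduct_kronecker_one_nonneg hKsa h1)
  obtain ⟨-, hR2⟩ := isUnit_and_inv_nonneg_of_compression hK1 hK2 (A := (lam B X)ᴴ)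
    ((Matrix.l2_opNorm_conjTranspose _).le.trans hA)
    (by
      rw [lam_conjTranspose]
      exact lam_mulVec_mem_sliceSubmodule (adj B) _)
    (re_dotProduct_kronecker_one_nonneg hKsa h2)
  rw [Matrix.conjTranspose_conjTranspose, sub_right_comm] at hR2
  change IsUnit (hermPencil K B X) at hunit
  refine ⟨pencil_adj K B X ▸ hunit, fun H =>
    ⟨_, hasComplexHessianAt_descriptorEval hunit c H, ?_⟩⟩
  have hRH : (hermPencil K B X)⁻¹.IsHermitian := (hermPencil_isHermitian hKsa B X).inv
  rw [hessian_eq_add_conj hKsa]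
  refine (posSemidef_conj_of_re_nonneg hRH _ fun z => hR1 _ ?_).add
    (posSemidef_conj_of_re_nonneg hRH _ fun z => hR2 _ ?_)
  · rw [Matrix.mul_assoc, ← Matrix.mulVec_mulVec]
    exact lam_mulVec_mem_sliceSubmodule B H _
  · rw [Matrix.mul_assoc, ← Matrix.mulVec_mulVec, lam_conjTranspose]
    exact lam_mulVec_mem_sliceSubmodule (adj B) _ _

end Sufficiency

/-! ### Plush realizations over arbitrary finite index types -/

section Transport

open scoped Matrix.Norms.L2Operator

variable {g d : ℕ}

theorem HasComplexHessianAt.unique {n : ℕ}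
    {f : MatTuple g n → MatTuple g n → Matrix (Fin n) (Fin n) ℂ} {X H : MatTuple g n}
    {L L' : Matrix (Fin n) (Fin n) ℂ} (h : HasComplexHessianAt f X H L)
    (h' : HasComplexHessianAt f X H L') : L = L' := by
  obtain ⟨D, hD, hL⟩ := h
  obtain ⟨D', hD', hL'⟩ := h'
  have hDD' : D =ᶠ[𝓝 0] D' := by
    filter_upwards [hD, hD'] with s h1 h2 using h1.unique h2
  exact hL.unique (hL'.congr_of_eventuallyEq hDD')

/-- Tuples of matrices of norm less than `ε / (g + 1)` lie in the column ball. Unlike the ball, this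
set is visibly open, and it is still closed under direct sums. -/
theorem mem_freeBall_of_norm_lt {ι : Type*} [Fintype ι] [DecidableEq ι] {ε : ℝ} (hε : 0 < ε)
    {X : Fin g → Matrix ι ι ℂ} (hX : ∀ j, ‖X j‖ < ε / (g + 1)) :
    ((((ε : ℂ) ^ 2) • (1 : Matrix ι ι ℂ) - ∑ j, (X j)ᴴ * X j).PosDef) := by
  rw [posDef_smul_one_sub_sum_gram_iff]
  intro x hx
  have hx' : 0 < ‖WithLp.toLp 2 x‖ ^ 2 :=
    pow_pos (norm_pos_iff.2 fun h => hx ((WithLp.toLp_eq_zero 2).1 h)) 2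
  have hg : (0 : ℝ) < g + 1 := by positivity
  calc ∑ j, ‖WithLp.toLp 2 (X j *ᵥ x)‖ ^ 2
      ≤ ∑ _j : Fin g, (ε / (g + 1)) ^ 2 * ‖WithLp.toLp 2 x‖ ^ 2 :=
        Finset.sum_le_sum fun j _ => (norm_sq_toLp_mulVec_le (X j) x).trans
          (mul_le_mul_of_nonneg_right (pow_le_pow_left₀ (norm_nonneg _) (hX j).le 2) hx'.le)
    _ = g * (ε / (g + 1)) ^ 2 * ‖WithLp.toLp 2 x‖ ^ 2 := by
        rw [Finset.sum_const, Finset.card_univ, Fintype.card_fin, nsmul_eq_mul, mul_assoc]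
    _ < ε ^ 2 * ‖WithLp.toLp 2 x‖ ^ 2 := by
        refine mul_lt_mul_of_pos_right ?_ hx'
        rw [div_pow, ← mul_div_assoc, div_lt_iff₀ (by positivity), mul_comm]
        refine mul_lt_mul_of_pos_left ?_ (by positivity)
        nlinarith [Nat.cast_nonneg (α := ℝ) g]

theorem re_hessian_form_nonneg_fin {K : Matrix (Fin d) (Fin d) ℂ} (hKsa : K.IsHermitian)
    {B : MatTuple g d} {c : Fin d → ℂ} {ε : ℝ} (hplush : IsPlushOn K B c (freeBall g ε)) {n : ℕ}
    {X : MatTuple g n} (hX : X ∈ freeBall g ε n) :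
    IsUnit (hermPencil K B X) ∧ ∀ (H : MatTuple g n) (z : Fin n → ℂ) (ξ : Fin d × Fin n → ℂ),
      hermPencil K B X *ᵥ ξ = tensorVec c z →
      0 ≤ (star (lam B H *ᵥ ξ) ⬝ᵥ (hermPencil K B X)⁻¹ *ᵥ (lam B H *ᵥ ξ)).re +
        (star ((lam B H)ᴴ *ᵥ ξ) ⬝ᵥ (hermPencil K B X)⁻¹ *ᵥ ((lam B H)ᴴ *ᵥ ξ)).re := by
  obtain ⟨hunit, hH⟩ := hplush n X hX
  rw [pencil_adj] at hunit
  refine ⟨hunit, fun H z ξ hξ => ?_⟩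
  obtain ⟨L, hL, hLpos⟩ := hH H
  rw [hL.unique (hasComplexHessianAt_descriptorEval hunit c H), hessian_eq_add_conj hKsa] at hLpos
  have hξ' : (hermPencil K B X)⁻¹ *ᵥ (colTensor c n *ᵥ z) = ξ := by
    rw [colTensor_mulVec, ← hξ, Matrix.mulVec_mulVec,
      Matrix.nonsing_inv_mul _ ((Matrix.isUnit_iff_isUnit_det _).1 hunit), Matrix.one_mulVec]
  have hconj : ∀ M R : Matrix (Fin d × Fin n) (Fin d × Fin n) ℂ,
      star z ⬝ᵥ ((M * (hermPencil K B X)⁻¹ * colTensor c n)ᴴ * R *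
        (M * (hermPencil K B X)⁻¹ * colTensor c n)) *ᵥ z = star (M *ᵥ ξ) ⬝ᵥ R *ᵥ (M *ᵥ ξ) := by
    intro M R
    rw [← Matrix.mulVec_mulVec, ← Matrix.mulVec_mulVec, Matrix.dotProduct_mulVec,
      ← Matrix.star_mulVec, ← Matrix.mulVec_mulVec, ← Matrix.mulVec_mulVec, hξ']
  have h := (Complex.le_def.1 (hLpos.dotProduct_mulVec_nonneg z)).1
  rw [Matrix.add_mulVec, dotProduct_add, hconj, hconj, Complex.add_re] at h
  exact h

theorem lam_submatrix {ι κ ι' κ' : Type*} (A : MatTuple g d) (X : Fin g → Matrix ι κ ℂ)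
    (e : ι' → ι) (f : κ' → κ) :
    lam A (fun j => (X j).submatrix e f) =
      (lam A X).submatrix (Prod.map id e) (Prod.map id f) := by
  ext p q
  simp [lam, Matrix.sum_apply]

/-- A plush realization has a nonnegative Hessian form at tuples indexed by any finite type, by
transport along an enumeration of the index type. In terms of a state vector `ξ = R (c ⊗ z)` the
form is `⟨A_H ξ, R A_H ξ⟩ + ⟨A_H* ξ, R A_H* ξ⟩` with `A_H = Λ_B(H)`. -/
theorem re_hessian_form_nonneg {K : Matrix (Fin d) (Fin d) ℂ} (hKsa : K.IsHermitian)
    {B : MatTuple g d} {c : Fin d → ℂ} {ε : ℝ} (hε : 0 < ε)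
    (hplush : IsPlushOn K B c (freeBall g ε)) {ι : Type*} [Fintype ι] [DecidableEq ι]
    {X : Fin g → Matrix ι ι ℂ} (hX : ∀ j, ‖X j‖ < ε / (g + 1)) :
    IsUnit (hermPencil K B X) ∧
      ∀ (H : Fin g → Matrix ι ι ℂ) (z : ι → ℂ) (ξ : Fin d × ι → ℂ),
      hermPencil K B X *ᵥ ξ = tensorVec c z →
      0 ≤ (star (lam B H *ᵥ ξ) ⬝ᵥ (hermPencil K B X)⁻¹ *ᵥ (lam B H *ᵥ ξ)).re +
        (star ((lam B H)ᴴ *ᵥ ξ) ⬝ᵥ (hermPencil K B X)⁻¹ *ᵥ ((lam B H)ᴴ *ᵥ ξ)).re := by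
  let e : Fin (Fintype.card ι) ≃ ι := (Fintype.equivFin ι).symm
  let f : Fin d × Fin (Fintype.card ι) ≃ Fin d × ι := (Equiv.refl _).prodCongr e
  have hlam : ∀ H : Fin g → Matrix ι ι ℂ,
      lam B (fun j => (H j).submatrix e e) = (lam B H).submatrix f f :=
    fun H => lam_submatrix B H e e
  have hpen : hermPencil K B (fun j => (X j).submatrix e e) = (hermPencil K B X).submatrix f f := by
    have h1 : K ⊗ₖ (1 : Matrix (Fin (Fintype.card ι)) (Fin (Fintype.card ι)) ℂ) =
        (K ⊗ₖ (1 : Matrix ι ι ℂ)).submatrix f f := by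
      ext p q
      simp [Matrix.one_apply, f]
    rw [hermPencil, hlam, h1, hermPencil]
    rfl
  have hball : (fun j => (X j).submatrix e e) ∈ freeBall g ε (Fintype.card ι) := by
    have h := (mem_freeBall_of_norm_lt hε hX).submatrix e.injective
    have h1 : (((ε : ℂ) ^ 2) • (1 : Matrix ι ι ℂ) - ∑ j, (X j)ᴴ * X j).submatrix e e =
        ((ε : ℂ) ^ 2) • (1 : Matrix (Fin (Fintype.card ι)) (Fin (Fintype.card ι)) ℂ) -
          ∑ j, ((X j).submatrix e e)ᴴ * (X j).submatrix e e := by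
      simp only [Matrix.conjTranspose_submatrix, Matrix.submatrix_mul_equiv]
      ext p q
      simp [Matrix.one_apply, Matrix.sum_apply]
    rw [h1] at h
    exact h
  obtain ⟨hunit, hform⟩ := re_hessian_form_nonneg_fin hKsa hplush hball
  rw [hpen, Matrix.isUnit_submatrix_equiv] at hunit
  refine ⟨hunit, fun H z ξ hξ => ?_⟩
  have hmv : ∀ (M : Matrix (Fin d × ι) (Fin d × ι) ℂ) (v : Fin d × ι → ℂ),
      M.submatrix f f *ᵥ (v ∘ f) = (M *ᵥ v) ∘ f := fun M v => by
    rw [Matrix.submatrix_mulVec_equiv, Function.comp_assoc, Equiv.self_comp_symm,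
      Function.comp_id]
  have hdot : ∀ v w : Fin d × ι → ℂ, star (v ∘ f) ⬝ᵥ (w ∘ f) = star v ⬝ᵥ w := fun v w =>
    comp_equiv_dotProduct_comp_equiv (star v) w f
  have h := hform (fun j => (H j).submatrix e e) (z ∘ e) (ξ ∘ f) (by
    rw [hpen, hmv, hξ]
    rfl)
  rw [hpen, hlam, Matrix.inv_submatrix_equiv, Matrix.conjTranspose_submatrix, hmv, hmv, hmv, hmv,
    hdot, hdot] at h
  exact h

end Transport

/-! ### Block tuples -/

section Blocks

variable {g d : ℕ} {ι κ : Type*}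

/-- The vector of `ℂᵈ ⊗ (ℂ^ι ⊕ ℂ^κ)` with components `v` and `w`. -/
def sumVec (v : Fin d × ι → ℂ) (w : Fin d × κ → ℂ) : Fin d × (ι ⊕ κ) → ℂ :=
  fun p => Sum.elim (fun i => v (p.1, i)) (fun k => w (p.1, k)) p.2

theorem sumVec_ext {v : Fin d × (ι ⊕ κ) → ℂ} {v₁ : Fin d × ι → ℂ} {v₂ : Fin d × κ → ℂ}
    (h₁ : ∀ i, slice v (Sum.inl i) = slice v₁ i) (h₂ : ∀ k, slice v (Sum.inr k) = slice v₂ k) :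
    v = sumVec v₁ v₂ := by
  ext ⟨a, i | k⟩
  · exact congrFun (h₁ i) a
  · exact congrFun (h₂ k) a

theorem star_sumVec_dotProduct [Fintype ι] [Fintype κ] (v v' : Fin d × ι → ℂ)
    (w w' : Fin d × κ → ℂ) :
    star (sumVec v w) ⬝ᵥ sumVec v' w' = star v ⬝ᵥ v' + star w ⬝ᵥ w' := by
  simp only [star_dotProduct_eq_sum_slice, Fintype.sum_sum_type]
  rfl

theorem lam_fromBlocks_mulVec [Fintype ι] [Fintype κ] (A : MatTuple g d)
    (P : Fin g → Matrix ι ι ℂ) (Q : Fin g → Matrix ι κ ℂ) (R : Fin g → Matrix κ ι ℂ)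
    (S : Fin g → Matrix κ κ ℂ) (v : Fin d × ι → ℂ) (w : Fin d × κ → ℂ) :
    lam A (fun j => Matrix.fromBlocks (P j) (Q j) (R j) (S j)) *ᵥ sumVec v w =
      sumVec (lam A P *ᵥ v + lam A Q *ᵥ w) (lam A R *ᵥ v + lam A S *ᵥ w) := by
  refine sumVec_ext (fun i => ?_) (fun k => ?_)
  · rw [slice_add, slice_lam_mulVec, slice_lam_mulVec, slice_lam_mulVec, ← Finset.sum_add_distrib]
    refine Finset.sum_congr rfl fun j _ => ?_
    rw [← Matrix.mulVec_add, Fintype.sum_sum_type]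
    rfl
  · rw [slice_add, slice_lam_mulVec, slice_lam_mulVec, slice_lam_mulVec, ← Finset.sum_add_distrib]
    refine Finset.sum_congr rfl fun j _ => ?_
    rw [← Matrix.mulVec_add, Fintype.sum_sum_type]
    rfl

theorem lam_fromBlocks_conjTranspose_mulVec [Fintype ι] [Fintype κ] (A : MatTuple g d)
    (P : Fin g → Matrix ι ι ℂ) (Q : Fin g → Matrix ι κ ℂ) (R : Fin g → Matrix κ ι ℂ)
    (S : Fin g → Matrix κ κ ℂ) (v : Fin d × ι → ℂ) (w : Fin d × κ → ℂ) :
    (lam A (fun j => Matrix.fromBlocks (P j) (Q j) (R j) (S j)))ᴴ *ᵥ sumVec v w =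
      sumVec ((lam A P)ᴴ *ᵥ v + (lam A R)ᴴ *ᵥ w) ((lam A Q)ᴴ *ᵥ v + (lam A S)ᴴ *ᵥ w) := by
  simp only [lam_conjTranspose, Matrix.fromBlocks_conjTranspose]
  exact lam_fromBlocks_mulVec _ _ _ _ _ _ _

theorem hermPencil_fromBlocks_mulVec [Fintype ι] [Fintype κ] [DecidableEq ι] [DecidableEq κ]
    (K : Matrix (Fin d) (Fin d) ℂ) (B : MatTuple g d)
    (P : Fin g → Matrix ι ι ℂ) (Q : Fin g → Matrix ι κ ℂ) (R : Fin g → Matrix κ ι ℂ)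
    (S : Fin g → Matrix κ κ ℂ) (v : Fin d × ι → ℂ) (w : Fin d × κ → ℂ) :
    hermPencil K B (fun j => Matrix.fromBlocks (P j) (Q j) (R j) (S j)) *ᵥ sumVec v w =
      sumVec (hermPencil K B P *ᵥ v - (lam B Q *ᵥ w + (lam B R)ᴴ *ᵥ w))
        (hermPencil K B S *ᵥ w - (lam B R *ᵥ v + (lam B Q)ᴴ *ᵥ v)) := by
  have hK : (K ⊗ₖ (1 : Matrix (ι ⊕ κ) (ι ⊕ κ) ℂ)) *ᵥ sumVec v w =
      sumVec ((K ⊗ₖ (1 : Matrix ι ι ℂ)) *ᵥ v) ((K ⊗ₖ (1 : Matrix κ κ ℂ)) *ᵥ w) := by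
    refine sumVec_ext (fun i => ?_) (fun k => ?_) <;>
    · rw [slice_one_kronecker_mulVec, slice_one_kronecker_mulVec]
      rfl
  simp only [hermPencil, Matrix.sub_mulVec]
  rw [hK, lam_fromBlocks_mulVec, lam_fromBlocks_conjTranspose_mulVec]
  ext ⟨a, i | k⟩ <;> simp only [sumVec, Pi.sub_apply, Pi.add_apply, Sum.elim_inl, Sum.elim_inr] <;>
    ring

open scoped Matrix.Norms.L2Operator in
theorem norm_fromBlocks_zero_le [Fintype ι] [Fintype κ] [DecidableEq ι] [DecidableEq κ]
    (P : Matrix ι ι ℂ) (S : Matrix κ κ ℂ) : ‖Matrix.fromBlocks P 0 0 S‖ ≤ max ‖P‖ ‖S‖ := by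
  have h0 : 0 ≤ max ‖P‖ ‖S‖ := (norm_nonneg P).trans (le_max_left _ _)
  refine l2_opNorm_le_of_forall h0 fun x => ?_
  have hsq : ∀ y : ι ⊕ κ → ℂ, ‖WithLp.toLp 2 y‖ ^ 2 =
      ‖WithLp.toLp 2 (y ∘ Sum.inl)‖ ^ 2 + ‖WithLp.toLp 2 (y ∘ Sum.inr)‖ ^ 2 := fun y => by
    simp only [EuclideanSpace.norm_sq_eq, Fintype.sum_sum_type, Function.comp_apply]
  rw [Matrix.fromBlocks_mulVec, hsq, hsq x, Sum.elim_comp_inl, Sum.elim_comp_inr,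
    Matrix.zero_mulVec, Matrix.zero_mulVec, add_zero, zero_add, mul_add]
  exact add_le_add
    ((norm_sq_toLp_mulVec_le P _).trans (mul_le_mul_of_nonneg_right
      (pow_le_pow_left₀ (norm_nonneg _) (le_max_left _ _) 2) (sq_nonneg _)))
    ((norm_sq_toLp_mulVec_le S _).trans (mul_le_mul_of_nonneg_right
      (pow_le_pow_left₀ (norm_nonneg _) (le_max_right _ _) 2) (sq_nonneg _)))

theorem hermPencil_zero_mulVec [Fintype ι] [DecidableEq ι] (K : Matrix (Fin d) (Fin d) ℂ)
    (B : MatTuple g d) (v : Fin d × ι → ℂ) (i : ι) :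
    slice (hermPencil K B (0 : Fin g → Matrix ι ι ℂ) *ᵥ v) i = K *ᵥ slice v i := by
  rw [hermPencil, lam_zero, Matrix.conjTranspose_zero, sub_zero, sub_zero, slice_one_kronecker_mulVec]

end Blocks

/-! ### Necessity: components of the state vectors -/

section Necessity

open scoped Matrix.Norms.L2Operator

variable {g d : ℕ} {K : Matrix (Fin d) (Fin d) ℂ} {B : MatTuple g d} {c : Fin d → ℂ} {δ : ℝ}

/-- A family `η` of vectors of `ℂᵈ` is a component family if, for some tuple `X` of matrices of
norm less than `δ` and some vectors `z` and `ξ` with `(K ⊗ I - Λ_B(X) - Λ_B(X)*) ξ = c ⊗ z`, each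
`ηₛ` is a linear combination of the slices of `ξ`. The tuples have arbitrary finite index types. -/
def IsComponentFamily (K : Matrix (Fin d) (Fin d) ℂ) (B : MatTuple g d) (c : Fin d → ℂ) (δ : ℝ)
    {σ : Type} (η : σ → Fin d → ℂ) : Prop :=
  ∃ (ι : Type) (_ : Fintype ι) (_ : DecidableEq ι) (X : Fin g → Matrix ι ι ℂ) (z : ι → ℂ)
    (ξ : Fin d × ι → ℂ) (h : σ → ι → ℂ), (∀ j, ‖X j‖ < δ) ∧
      hermPencil K B X *ᵥ ξ = tensorVec c z ∧ ∀ s, η s = ∑ k, h s k • slice ξ k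

theorem IsComponentFamily.zero (hδ : 0 < δ) (σ : Type) :
    IsComponentFamily K B c δ (0 : σ → Fin d → ℂ) := by
  refine ⟨PEmpty, inferInstance, inferInstance, 0, 0, 0, 0, fun j => ?_, ?_, fun s => ?_⟩
  · simpa using hδ
  · ext ⟨_, i⟩
    exact i.elim
  · simp

theorem IsComponentFamily.add {σ : Type} {η θ : σ → Fin d → ℂ}
    (hη : IsComponentFamily K B c δ η) (hθ : IsComponentFamily K B c δ θ) :
    IsComponentFamily K B c δ (η + θ) := by
  obtain ⟨ι, _, _, X, z, ξ, h, hX, hξ, hη⟩ := hη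
  obtain ⟨κ, _, _, Y, y, ζ, k, hY, hζ, hθ⟩ := hθ
  refine ⟨ι ⊕ κ, inferInstance, inferInstance, fun j => Matrix.fromBlocks (X j) 0 0 (Y j),
    Sum.elim z y, sumVec ξ ζ, fun s => Sum.elim (h s) (k s), fun j => ?_, ?_, fun s => ?_⟩
  · exact (norm_fromBlocks_zero_le _ _).trans_lt (max_lt (hX j) (hY j))
  · have h := hermPencil_fromBlocks_mulVec K B X 0 0 Y ξ ζ
    simp only [lam_zero, Matrix.conjTranspose_zero, Matrix.zero_mulVec, add_zero, sub_zero,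
      Pi.zero_apply, hξ, hζ] at h
    rw [h]
    ext ⟨a, i | i⟩ <;> rfl
  · rw [Fintype.sum_sum_type, Pi.add_apply, hη, hθ]
    rfl

theorem IsComponentFamily.comp_linear {σ τ : Type} [Fintype σ] {η : σ → Fin d → ℂ}
    (hη : IsComponentFamily K B c δ η) (M : Matrix τ σ ℂ) :
    IsComponentFamily K B c δ (fun t => ∑ s, M t s • η s) := by
  obtain ⟨ι, _, _, X, z, ξ, h, hX, hξ, hη⟩ := hη
  refine ⟨ι, inferInstance, inferInstance, X, z, ξ, fun t k => ∑ s, M t s * h s k, hX, hξ,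
    fun t => ?_⟩
  simp only [hη, Finset.smul_sum, Finset.sum_smul, smul_smul]
  exact Finset.sum_comm

/-- The subspace of `ℂᵈ` of all linear combinations of slices of state vectors of tuples of norm
less than `δ`; it consists of the `v` for which the family with the single member `v` is a component
family. -/
def componentSubmodule (K : Matrix (Fin d) (Fin d) ℂ) (B : MatTuple g d) (c : Fin d → ℂ) {δ : ℝ}
    (hδ : 0 < δ) : Submodule ℂ (Fin d → ℂ) where
  carrier := {v | IsComponentFamily K B c δ fun _ : Unit => v}
  add_mem' hv hw := hv.add hw
  zero_mem' := IsComponentFamily.zero hδ Unit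
  smul_mem' r v hv := by
    simpa using IsComponentFamily.comp_linear hv (Matrix.of fun _ _ : Unit => r)

/-- Components of different state vectors can be realized together, by a direct sum of tuples. -/
theorem isComponentFamily_of_componentSubmodule_eq_top {hδ : 0 < δ}
    (htop : componentSubmodule K B c hδ = ⊤) {σ : Type} [Fintype σ] [DecidableEq σ]
    (η : σ → Fin d → ℂ) : IsComponentFamily K B c δ η := by
  have hsum : ∀ S : Finset σ, IsComponentFamily K B c δ (∑ s ∈ S, Pi.single s (η s)) := by
    intro S
    induction S using Finset.induction_on with
    | empty => exact IsComponentFamily.zero hδ σ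
    | insert s S hs ih =>
      rw [Finset.sum_insert hs]
      refine IsComponentFamily.add ?_ ih
      have hmem : η s ∈ componentSubmodule K B c hδ := htop ▸ Submodule.mem_top
      have h := IsComponentFamily.comp_linear hmem
        (Matrix.of fun (t : σ) (_ : Unit) => (Pi.single s 1 : σ → ℂ) t)
      convert h using 2 with t
      by_cases ht : t = s
      · subst ht
        simp
      · simp [ht]
  simpa [Finset.univ_sum_single] using hsum Finset.univ

theorem mulVec_mem_componentSubmodule (hK : K * K = 1) (hδ : 0 < δ) :
    K *ᵥ c ∈ componentSubmodule K B c hδ := by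
  refine ⟨Unit, inferInstance, inferInstance, 0, 1, tensorVec (K *ᵥ c) 1, 1, fun j => ?_, ?_,
    fun _ => ?_⟩
  · simpa using hδ
  · ext ⟨a, i⟩
    have h := congrFun (hermPencil_zero_mulVec K B (tensorVec (K *ᵥ c) (1 : Unit → ℂ)) i) a
    have h1 : slice (tensorVec (K *ᵥ c) (1 : Unit → ℂ)) i = K *ᵥ c := by
      ext b
      simp [slice, tensorVec]
    rw [h1, Matrix.mulVec_mulVec, hK, Matrix.one_mulVec] at h
    simpa [slice, tensorVec] using h
  · ext b
    simp [slice, tensorVec]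

theorem hermPencil_add_real_smul {ι : Type*} [DecidableEq ι] (K : Matrix (Fin d) (Fin d) ℂ)
    (B : MatTuple g d) (X H : Fin g → Matrix ι ι ℂ) (t : ℝ) :
    hermPencil K B (X + t • H) = hermPencil K B X - t • (lam B H + (lam B H)ᴴ) := by
  rw [hermPencil, hermPencil, lam_add, lam_real_smul, Matrix.conjTranspose_add,
    Matrix.conjTranspose_smul, star_trivial, smul_add]
  abel

/-- Coupling a tuple `X` to one further dimension by a small off-diagonal perturbation adds to the
components of the state vector `ξ` a multiple of `K (Λ_B(q) + Λ_B(p)*) ξ`, up to a small error,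
which disappears in the limit as the subspace of components is closed. -/
theorem mulVec_slice_lam_mem_componentSubmodule (hK : K * K = 1) (hδ : 0 < δ)
    (hunit : ∀ {ι : Type} [Fintype ι] [DecidableEq ι] {X : Fin g → Matrix ι ι ℂ},
      (∀ j, ‖X j‖ < δ) → IsUnit (hermPencil K B X))
    {ι : Type} [Fintype ι] [DecidableEq ι] {X : Fin g → Matrix ι ι ℂ} (hX : ∀ j, ‖X j‖ < δ)
    {z : ι → ℂ} {ξ : Fin d × ι → ℂ} (hξ : hermPencil K B X *ᵥ ξ = tensorVec c z)
    (p : Fin g → Matrix ι Unit ℂ) (q : Fin g → Matrix Unit ι ℂ) :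
    K *ᵥ slice (lam B q *ᵥ ξ + (lam B p)ᴴ *ᵥ ξ) () ∈ componentSubmodule K B c hδ := by
  let X₀ : Fin g → Matrix (ι ⊕ Unit) (ι ⊕ Unit) ℂ := fun j => Matrix.fromBlocks (X j) 0 0 0
  let H : Fin g → Matrix (ι ⊕ Unit) (ι ⊕ Unit) ℂ := fun j => Matrix.fromBlocks 0 (p j) (q j) 0
  let y : ι ⊕ Unit → ℂ := Sum.elim z 0
  have hX₀ : ∀ j, ‖X₀ j‖ < δ := fun j =>
    (norm_fromBlocks_zero_le _ _).trans_lt (max_lt (hX j) (by simpa using hδ))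
  let N : ℝ → Matrix (Fin d × (ι ⊕ Unit)) (Fin d × (ι ⊕ Unit)) ℂ :=
    fun t => hermPencil K B (X₀ + t • H)
  have hN0 : N 0 = hermPencil K B X₀ := by simp only [N, zero_smul, add_zero]
  have hunit0 : IsUnit (N 0) := hN0 ▸ hunit hX₀
  have hsmall : ∀ᶠ t in 𝓝 (0 : ℝ), ∀ j, ‖(X₀ + t • H) j‖ < δ := by
    refine Filter.eventually_all.2 fun j => ?_
    have hc : ContinuousAt (fun t : ℝ => ‖X₀ j + t • H j‖) 0 := by fun_prop
    exact hc.eventually_lt_const (by simpa using hX₀ j)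
  let Ξ : ℝ → Fin d × (ι ⊕ Unit) → ℂ := fun t => (N t)⁻¹ *ᵥ tensorVec c y
  let ξ₁ : ℝ → Fin d × ι → ℂ := fun t p => Ξ t (p.1, Sum.inl p.2)
  let ξ₂ : ℝ → Fin d × Unit → ℂ := fun t p => Ξ t (p.1, Sum.inr p.2)
  have hΞ : ∀ t, Ξ t = sumVec (ξ₁ t) (ξ₂ t) := fun t =>
    sumVec_ext (fun _ => rfl) (fun _ => rfl)
  have hsolve : ∀ t, IsUnit (N t) → N t *ᵥ Ξ t = tensorVec c y := fun t ht => by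
    rw [Matrix.mulVec_mulVec, Matrix.mul_nonsing_inv _ ((Matrix.isUnit_iff_isUnit_det _).1 ht),
      Matrix.one_mulVec]
  have hΞ0 : ξ₁ 0 = ξ := by
    have h : N 0 *ᵥ sumVec ξ 0 = tensorVec c y := by
      have h := hermPencil_fromBlocks_mulVec K B X 0 0 (0 : Fin g → Matrix Unit Unit ℂ) ξ 0
      simp only [lam_zero, Matrix.conjTranspose_zero, Matrix.zero_mulVec, Matrix.mulVec_zero,
        add_zero, sub_zero, Pi.zero_apply, hξ] at h
      rw [hN0, h]
      ext ⟨a, i | i⟩ <;> simp [sumVec, tensorVec, y]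
    have h' : Ξ 0 = sumVec ξ 0 := by
      simp only [Ξ]
      rw [← h, Matrix.mulVec_mulVec,
        Matrix.nonsing_inv_mul _ ((Matrix.isUnit_iff_isUnit_det _).1 hunit0), Matrix.one_mulVec]
    ext ⟨a, i⟩
    exact congrFun h' (a, Sum.inl i)
  have hcont : ContinuousAt Ξ 0 := by
    have hNc : Continuous N := by
      simp only [N, hermPencil_add_real_smul]
      fun_prop
    have hinv : ContinuousAt (fun t => (N t)⁻¹) 0 := by
      simp only [Matrix.nonsing_inv_eq_ringInverse]
      obtain ⟨u, hu⟩ := hunit0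
      exact ContinuousAt.comp (g := Ring.inverse) (hu ▸ NormedRing.inverse_continuousAt u)
        hNc.continuousAt
    have hmv : Continuous fun M : Matrix (Fin d × (ι ⊕ Unit)) (Fin d × (ι ⊕ Unit)) ℂ =>
        M *ᵥ tensorVec c y := by fun_prop
    exact hmv.continuousAt.comp hinv
  let F : ℝ → Fin d → ℂ := fun t => K *ᵥ slice (lam B q *ᵥ ξ₁ t + (lam B p)ᴴ *ᵥ ξ₁ t) ()
  have hF : ContinuousAt F 0 := by
    have h1 : Continuous fun Z : Fin d × (ι ⊕ Unit) → ℂ =>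
        K *ᵥ slice (lam B q *ᵥ (fun p => Z (p.1, Sum.inl p.2)) +
          (lam B p)ᴴ *ᵥ (fun p => Z (p.1, Sum.inl p.2))) () := by
      have hslice : Continuous fun v : Fin d × Unit → ℂ => slice v () :=
        continuous_pi fun a => continuous_apply (a, ())
      exact continuous_const.matrix_mulVec (hslice.comp (by fun_prop))
    exact h1.continuousAt.comp hcont
  have hmem : ∀ᶠ t in 𝓝[≠] (0 : ℝ), F t ∈ componentSubmodule K B c hδ := by
    filter_upwards [hsmall.filter_mono nhdsWithin_le_nhds, self_mem_nhdsWithin] with t ht ht0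
    have hNt := hsolve t (hunit ht)
    have hslice : slice (ξ₂ t) () ∈ componentSubmodule K B c hδ := by
      refine ⟨ι ⊕ Unit, inferInstance, inferInstance, X₀ + t • H, y, Ξ t,
        fun _ => Sum.elim 0 1, ht, hNt, fun _ => ?_⟩
      rw [Fintype.sum_sum_type]
      simp only [Sum.elim_inl, Sum.elim_inr, Pi.zero_apply, Pi.one_apply, zero_smul,
        Finset.sum_const_zero, zero_add, one_smul, Finset.univ_unique, Finset.sum_singleton]
      rfl
    -- The second block row of the equation reads `K ξ₂ = t (Λ_B(q) + Λ_B(p)*) ξ₁`.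
    have hrow : K *ᵥ slice (ξ₂ t) () =
        t • slice (lam B q *ᵥ ξ₁ t + (lam B p)ᴴ *ᵥ ξ₁ t) () := by
      have hXt : X₀ + t • H = fun j => Matrix.fromBlocks (X j) ((t • p) j) ((t • q) j)
          ((0 : Fin g → Matrix Unit Unit ℂ) j) := by
        ext1 j
        simp [X₀, H, Matrix.fromBlocks_smul, Matrix.fromBlocks_add]
      have h := hermPencil_fromBlocks_mulVec K B X (t • p) (t • q) 0 (ξ₁ t) (ξ₂ t)
      rw [← hXt, ← hΞ] at h
      change N t *ᵥ Ξ t = _ at h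
      rw [hNt] at h
      have h1 : slice (tensorVec c y) (Sum.inr ()) = 0 := by
        ext a
        simp [slice, tensorVec, y]
      rw [h] at h1
      have h2 : slice (hermPencil K B (0 : Fin g → Matrix Unit Unit ℂ) *ᵥ ξ₂ t) () -
          slice (lam B (t • q) *ᵥ ξ₁ t + (lam B (t • p))ᴴ *ᵥ ξ₁ t) () = 0 := h1
      rw [hermPencil_zero_mulVec, sub_eq_zero, lam_real_smul, lam_real_smul,
        Matrix.conjTranspose_smul, star_trivial, Matrix.smul_mulVec, Matrix.smul_mulVec,
        ← smul_add] at h2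
      exact h2
    have hKK : slice (ξ₂ t) () = t • F t := by
      rw [← Matrix.one_mulVec (slice (ξ₂ t) ()), ← hK, ← Matrix.mulVec_mulVec, hrow,
        Matrix.mulVec_smul]
    have hFt : F t = (t : ℂ)⁻¹ • slice (ξ₂ t) () := by
      rw [hKK, ← Complex.coe_smul, smul_smul, inv_mul_cancel₀ (by exact_mod_cast ht0), one_smul]
    rw [hFt]
    exact Submodule.smul_mem _ _ hslice
  have hclosed : IsClosed (componentSubmodule K B c hδ : Set (Fin d → ℂ)) :=
    Submodule.closed_of_finiteDimensional _
  have hlim : F 0 ∈ componentSubmodule K B c hδ :=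
    hclosed.mem_of_tendsto (hF.tendsto.mono_left nhdsWithin_le_nhds) hmem
  simpa only [F, hΞ0] using hlim

theorem slice_lam_single_mulVec {ι : Type*} [Fintype ι] (A : MatTuple g d) (j : Fin g)
    (h : ι → ℂ) (ξ : Fin d × ι → ℂ) :
    slice (lam A (Pi.single j (Matrix.of fun (_ : Unit) k => h k)) *ᵥ ξ) () =
      A j *ᵥ ∑ k, h k • slice ξ k := by
  rw [slice_lam_mulVec, Finset.sum_eq_single j]
  · simp
  · intro i _ hij
    simp [hij]
  · simp

theorem componentSubmodule_invariant (hK : K * K = 1) (hδ : 0 < δ)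
    (hunit : ∀ {ι : Type} [Fintype ι] [DecidableEq ι] {X : Fin g → Matrix ι ι ℂ},
      (∀ j, ‖X j‖ < δ) → IsUnit (hermPencil K B X)) (j : Fin g) {v : Fin d → ℂ}
    (hv : v ∈ componentSubmodule K B c hδ) :
    K *ᵥ (B j *ᵥ v) ∈ componentSubmodule K B c hδ ∧
      K *ᵥ ((B j)ᴴ *ᵥ v) ∈ componentSubmodule K B c hδ := by
  obtain ⟨ι, _, _, X, z, ξ, h, hX, hξ, hη⟩ := hv
  have hv : v = ∑ k, h () k • slice ξ k := hη ()
  have h0' : lam B (0 : Fin g → Matrix ι Unit ℂ) = 0 := by simp [lam]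
  constructor
  · have := mulVec_slice_lam_mem_componentSubmodule hK hδ hunit hX hξ 0
      (Pi.single j (Matrix.of fun (_ : Unit) k => h () k))
    rwa [lam_zero, Matrix.conjTranspose_zero, Matrix.zero_mulVec, add_zero, slice_lam_single_mulVec,
      ← hv] at this
  · have := mulVec_slice_lam_mem_componentSubmodule hK hδ hunit hX hξ
      (fun i => ((Pi.single j (Matrix.of fun (_ : Unit) k => h () k) :
        Fin g → Matrix Unit ι ℂ) i)ᴴ) 0
    rw [lam_zero, Matrix.zero_mulVec, zero_add, lam_conjTranspose] at this
    simp only [Matrix.conjTranspose_conjTranspose] at this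
    rw [slice_lam_single_mulVec, ← hv] at this
    exact this

theorem componentSubmodule_eq_top (hK : K * K = 1) (hδ : 0 < δ)
    (hunit : ∀ {ι : Type} [Fintype ι] [DecidableEq ι] {X : Fin g → Matrix ι ι ℂ},
      (∀ j, ‖X j‖ < δ) → IsUnit (hermPencil K B X)) (hmin : IsMinimal K B c) :
    componentSubmodule K B c hδ = ⊤ := by
  have hword : ∀ w : FreeMonoid (Fin g ⊕ Fin g),
      K *ᵥ (FreeMonoid.lift (Sum.elim (fun j => B j * K) (fun j => (B j)ᴴ * K)) w *ᵥ c) ∈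
        componentSubmodule K B c hδ := by
    intro w
    induction w using FreeMonoid.inductionOn' with
    | one => simpa using mulVec_mem_componentSubmodule hK hδ
    | of_mul x w ih =>
      rw [map_mul, FreeMonoid.lift_eval_of, ← Matrix.mulVec_mulVec]
      obtain j | j := x
      · rw [Sum.elim_inl, ← Matrix.mulVec_mulVec]
        exact (componentSubmodule_invariant hK hδ hunit j ih).1
      · rw [Sum.elim_inr, ← Matrix.mulVec_mulVec]
        exact (componentSubmodule_invariant hK hδ hunit j ih).2
  have hle : (⊤ : Submodule ℂ (Fin d → ℂ)) ≤
      (componentSubmodule K B c hδ).comap (Matrix.mulVecLin K) := by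
    rw [← hmin, Submodule.span_le]
    rintro _ ⟨w, rfl⟩
    exact hword w
  refine eq_top_iff.2 fun v _ => ?_
  have h : K *ᵥ (K *ᵥ v) ∈ componentSubmodule K B c hδ := hle (Submodule.mem_top (x := K *ᵥ v))
  rwa [Matrix.mulVec_mulVec, hK, Matrix.one_mulVec] at h

theorem exists_eq_sum_mulVec_of_mem_ran (A : MatTuple g d) {v : EuclideanSpace ℂ (Fin d)}
    (hv : v ∈ ran A) : ∃ η : Fin g → Fin d → ℂ, v.ofLp = ∑ j, A j *ᵥ η j := by
  refine Submodule.iSup_induction _ (motive := fun v : EuclideanSpace ℂ (Fin d) =>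
    ∃ η : Fin g → Fin d → ℂ, v.ofLp = ∑ j, A j *ᵥ η j) hv ?_ ⟨0, by simp⟩ ?_
  · rintro j _ ⟨x, rfl⟩
    refine ⟨Pi.single j x.ofLp, ?_⟩
    rw [Finset.sum_eq_single j]
    · simp
    · intro i _ hij
      simp [hij]
    · simp
  · rintro x y ⟨η, hη⟩ ⟨θ, hθ⟩
    exact ⟨η + θ, by simp [hη, hθ, Matrix.mulVec_add, Finset.sum_add_distrib]⟩

/-- The Hessian at `X ⊕ 0` in an off-diagonal direction, on the state vector `ξ ⊕ 0`. As the pencil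
at `X ⊕ 0` is `K` on the last summand, the form of the Hessian is that of `K`. -/
theorem re_form_slice_lam_nonneg (hK : K * K = 1) (hKsa : K.IsHermitian) {ε : ℝ} (hε : 0 < ε)
    (hplush : IsPlushOn K B c (freeBall g ε)) {ι : Type} [Fintype ι] [DecidableEq ι]
    {X : Fin g → Matrix ι ι ℂ} (hX : ∀ j, ‖X j‖ < ε / (g + 1)) {z : ι → ℂ} {ξ : Fin d × ι → ℂ}
    (hξ : hermPencil K B X *ᵥ ξ = tensorVec c z)
    (p : Fin g → Matrix ι Unit ℂ) (q : Fin g → Matrix Unit ι ℂ) :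
    0 ≤ (star (slice (lam B q *ᵥ ξ) ()) ⬝ᵥ K *ᵥ slice (lam B q *ᵥ ξ) ()).re +
      (star (slice ((lam B p)ᴴ *ᵥ ξ) ()) ⬝ᵥ K *ᵥ slice ((lam B p)ᴴ *ᵥ ξ) ()).re := by
  let X₀ : Fin g → Matrix (ι ⊕ Unit) (ι ⊕ Unit) ℂ := fun j => Matrix.fromBlocks (X j) 0 0 0
  have hX₀ : ∀ j, ‖X₀ j‖ < ε / (g + 1) := fun j =>
    (norm_fromBlocks_zero_le _ _).trans_lt (max_lt (hX j) (by simpa using (by positivity)))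
  have hpen : ∀ (v : Fin d × ι → ℂ) (w : Fin d × Unit → ℂ), hermPencil K B X₀ *ᵥ sumVec v w =
      sumVec (hermPencil K B X *ᵥ v) (hermPencil K B (0 : Fin g → Matrix Unit Unit ℂ) *ᵥ w) := by
    intro v w
    have h := hermPencil_fromBlocks_mulVec K B X 0 0 (0 : Fin g → Matrix Unit Unit ℂ) v w
    simpa only [lam_zero, Matrix.conjTranspose_zero, Matrix.zero_mulVec, add_zero, sub_zero,
      Pi.zero_apply] using h
  obtain ⟨hunit, hform⟩ := re_hessian_form_nonneg hKsa hε hplush hX₀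
  have hinv : ∀ w : Fin d × Unit → ℂ, (hermPencil K B X₀)⁻¹ *ᵥ sumVec (0 : Fin d × ι → ℂ) w =
      sumVec 0 (fun p => (K *ᵥ slice w p.2) p.1) := by
    intro w
    have h : sumVec (0 : Fin d × ι → ℂ) w =
        hermPencil K B X₀ *ᵥ sumVec 0 (fun p => (K *ᵥ slice w p.2) p.1) := by
      rw [hpen, Matrix.mulVec_zero]
      congr 1
      ext ⟨a, i⟩
      have h := congrFun (hermPencil_zero_mulVec K B (fun p => (K *ᵥ slice w p.2) p.1) i) a
      have h' : slice (fun p : Fin d × Unit => (K *ᵥ slice w p.2) p.1) i = K *ᵥ slice w i := rfl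
      rw [h', Matrix.mulVec_mulVec, hK, Matrix.one_mulVec] at h
      exact h.symm
    rw [h, Matrix.mulVec_mulVec,
      Matrix.nonsing_inv_mul _ ((Matrix.isUnit_iff_isUnit_det _).1 hunit), Matrix.one_mulVec]
  have h := hform (fun j => Matrix.fromBlocks 0 (p j) (q j) 0) (Sum.elim z 0) (sumVec ξ 0) (by
    rw [hpen, hξ, Matrix.mulVec_zero]
    ext ⟨a, i | i⟩ <;> simp [sumVec, tensorVec])
  have hH1 := lam_fromBlocks_mulVec B 0 p q 0 ξ 0
  have hH2 := lam_fromBlocks_conjTranspose_mulVec B 0 p q 0 ξ 0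
  simp only [Matrix.mulVec_zero, add_zero, lam_zero, Matrix.conjTranspose_zero,
    Matrix.zero_mulVec, Pi.zero_apply] at hH1 hH2
  rw [hH1, hH2, hinv, hinv, star_sumVec_dotProduct, star_sumVec_dotProduct,
    star_dotProduct_eq_sum_slice (lam B q *ᵥ ξ), star_dotProduct_eq_sum_slice ((lam B p)ᴴ *ᵥ ξ)] at h
  simpa using! h

theorem compressionNonneg_of_isPlushOn (hK : K * K = 1) (hKsa : K.IsHermitian)
    (hmin : IsMinimal K B c) {ε : ℝ} (hε : 0 < ε) (hplush : IsPlushOn K B c (freeBall g ε)) :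
    CompressionNonneg K (ran B) ∧ CompressionNonneg K (ran (adj B)) := by
  have hδ : 0 < ε / (g + 1) := by positivity
  have htop : componentSubmodule K B c hδ = ⊤ := componentSubmodule_eq_top hK hδ
    (fun hX => (re_hessian_form_nonneg hKsa hε hplush hX).1) hmin
  have hrow : ∀ {ι : Type} [Fintype ι] (A : MatTuple g d) (h : Fin g → ι → ℂ)
      (ξ : Fin d × ι → ℂ), slice (lam A (fun j => Matrix.of fun (_ : Unit) k => h j k) *ᵥ ξ) () =
        ∑ j, A j *ᵥ ∑ k, h j k • slice ξ k := fun A h ξ => slice_lam_mulVec A _ ξ ()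
  constructor <;> rw [compressionNonneg_iff hKsa] <;> intro v hv
  · obtain ⟨η, hη⟩ := exists_eq_sum_mulVec_of_mem_ran B hv
    obtain ⟨ι, _, _, X, z, ξ, h, hX, hξ, hηξ⟩ :=
      isComponentFamily_of_componentSubmodule_eq_top htop η
    have := re_form_slice_lam_nonneg hK hKsa hε hplush hX hξ 0
      (fun j => Matrix.of fun (_ : Unit) k => h j k)
    have hs0 : slice (0 : Fin d × Unit → ℂ) () = 0 := rfl
    simp only [hrow, ← hηξ, ← hη, lam_zero, Matrix.conjTranspose_zero, Matrix.zero_mulVec, hs0,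
      star_zero, zero_dotProduct, Complex.zero_re, add_zero] at this
    exact this
  · obtain ⟨η, hη⟩ := exists_eq_sum_mulVec_of_mem_ran (adj B) hv
    obtain ⟨ι, _, _, X, z, ξ, h, hX, hξ, hηξ⟩ :=
      isComponentFamily_of_componentSubmodule_eq_top htop η
    have := re_form_slice_lam_nonneg hK hKsa hε hplush hX hξ
      (fun j => (Matrix.of fun (_ : Unit) k => h j k)ᴴ) 0
    have hs0 : slice (0 : Fin d × Unit → ℂ) () = 0 := rfl
    simp only [lam_conjTranspose, Matrix.conjTranspose_conjTranspose, hrow, ← hηξ, ← hη, lam_zero,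
      Matrix.zero_mulVec, hs0, star_zero, zero_dotProduct, Complex.zero_re, zero_add] at this
    exact this

end Necessity

end NCPlush

theorem theorem1p2 {g d : ℕ} (K : Matrix (Fin d) (Fin d) ℂ) (hK : K * K = 1)
    (hKsa : K.IsHermitian) (B : NCPlush.MatTuple g d) (c : Fin d → ℂ) :
    ((NCPlush.CompressionNonneg K (NCPlush.ran B) ∧
        NCPlush.CompressionNonneg K (NCPlush.ran (NCPlush.adj B))) →
      ∃ ε : ℝ, 0 < ε ∧ NCPlush.IsPlushOn K B c (NCPlush.freeBall g ε)) ∧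
    (NCPlush.IsMinimal K B c →
      ((∃ ε : ℝ, 0 < ε ∧ NCPlush.IsPlushOn K B c (NCPlush.freeBall g ε)) ↔
        (NCPlush.CompressionNonneg K (NCPlush.ran B) ∧
          NCPlush.CompressionNonneg K (NCPlush.ran (NCPlush.adj B))))) := by
  refine ⟨fun h => NCPlush.exists_isPlushOn_freeBall hK hKsa B c h.1 h.2, fun hmin => ⟨?_, ?_⟩⟩
  · rintro ⟨ε, hε, hplush⟩
    exact NCPlush.compressionNonneg_of_isPlushOn hK hKsa hmin hε hplush
  · exact fun h => NCPlush.exists_isPlushOn_freeBall hK hKsa B c h.1 h.2
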